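/- **Setting.** Let $\{p(y|x): x\in\{0,1\},\,y\in\mathcal Y\}$ be a binary input memoryless channel with discrete or continuous output, given by densities with respect to a reference measure $dy$ on $\mathcal Y$. Let $X$ be uniform on $\{0,1\}$, $Y$ the corresponding output, $p(x|y)=p(y|x)/(p(y|0)+p(y|1))$, and let $(X^n,Y^n)$ be $n$ independent copies of $(X,Y)$; logarithms are natural. The channel is a BIMSC: $-\ln p(0|Y)$ given $X=0$ and $-\ln p(1|Y)$ given $X=1$ have the same distribution. Let $C$ be its capacity, $H(X|Y)=\mathbf E[-\ln p(X|Y)]$, $\lambda^*=\sup\{\lambda\ge 0:\mathbf E[p(X|Y)^{-\lambda}]<\infty\}$, and $$r(\delta)=\sup_{\lambda\ge0}\big[\lambda(H(X|Y)+\delta)-\ln\mathbf E[p(X|Y)^{-\lambda}]\big].$$ For $0\le\lambda<\lambda^*$ let $(X_\lambda,Y_\lambda)$ have density $p(x|y)^{-\lambda}/\mathbf E[p(X|Y)^{-\lambda}]$ with respect to the law of $(X,Y)$; let $\delta(\lambda)=\mathbf E[-\ln p(X_\lambda|Y_\lambda)]-H(X|Y)$, and let $\sigma_H(\lambda)$ and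 $M_H(\lambda)$ be the standard deviation and the third absolute central moment of $-\ln p(X_\lambda|Y_\lambda)$. Write $\sigma_H=\sigma_H(0)$, $M_H=M_H(0)$ and assume $\sigma_H>0$. Let $Q(z)=\frac1{\sqrt{2\pi}}\int_z^\infty e^{-t^2/2}dt$, let $C_{BE}$ be the (best) universal constant in the Berry–Esseen theorem for i.i.d. sums, and let $$\underline\xi(\lambda,n)=e^{n\lambda^2\sigma_H^2(\lambda)/2}\,Q\big(\rho_*+\sqrt n\,\lambda\,\sigma_H(\lambda)\big),\qquad Q(\rho_*)=\frac12-\frac{2C_{BE}M_H(\lambda)}{\sqrt n\,\sigma_H^3(\lambda)},$$ which is defined when the last right-hand side is positive. Finally let $B_{n,\delta}=\bigcup_{x^n}\{y^n:\infty>-\frac1n\ln p(x^n|y^n)>H(X|Y)+\delta\}$ and $P(B_{n,\delta})=\Pr\{Y^n\in B_{n,\delta}\}$. **Statement.** Let $n\ge1$, $0<\epsilon_n<1$, and let $\mathcal C_n$ be any channel code of block length $n$ (pairwise disjoint decision regions) with maximum error probability $P_m(\mathcal C_n)\le\epsilon_n$ (in particular one with $P_m(\mathcal C_n)=\epsilon_n$).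 Let $R(\mathcal C_n)$ be its rate in nats per channel use. Then $$R(\mathcal C_n)\le C-\delta-\frac{\ln\epsilon_n+\ln\Big(\frac1{\sigma_H}\sqrt{\frac{-2\ln\epsilon_n}{n}}\Big)-\ln P(B_{n,\delta})}{n}\qquad(1)$$ for every real $\delta$ such that $$\Big(1+\frac1{\sigma_H}\sqrt{\frac{-2\ln\epsilon_n}{n}}\Big)\epsilon_n\le\Pr\Big\{-\frac1n\ln p(X^n|Y^n)>H(X|Y)+\delta\Big\},$$ in particular for the largest such $\delta$ when there is a largest one. Moreover: 1. (1) holds whenever $\delta=\delta(\lambda)$ with $0\le\lambda<\lambda^*$, $\rho_*$ is defined, and $$\Big(1+\frac1{\sigma_H}\sqrt{\frac{-2\ln\epsilon_n}{n}}\Big)\epsilon_n=\underline\xi(\lambda,n)\,e^{-n\,r(\delta)}.$$ 2. If $\epsilon_n=\epsilon$ and $a_n(\epsilon):=\epsilon+\frac1{\sqrt n}\Big(\frac{\sqrt{-2\ln\epsilon}}{\sigma_H}\epsilon+\frac{C_{BE}M_H}{\sigma_H^3}\Big)<1$, then $$R(\mathcal C_n)\le C-\frac{\ln\epsilon+\ln\Big(\frac1{\sigma_H}\sqrt{\frac{-2\ln\epsilon}{n}}\Big)}{n}-\frac{\sigma_H}{\sqrt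 n}Q^{-1}\big(a_n(\epsilon)\big),$$ and for every constant $\epsilon\in(0,1)$ the right-hand side equals $C-\frac{\sigma_H}{\sqrt n}Q^{-1}(\epsilon)+\frac{\ln n}{2n}+O(n^{-1})$ as $n\to\infty$. -/

import Mathlib

open MeasureTheory ProbabilityTheory Filter
open scoped ENNReal NNReal

noncomputable section

/-- The Gaussian tail function `Q z = (1 / √(2π)) ∫_z^∞ e^{-t²/2} dt`. -/
def gaussianQ (z : ℝ) : ℝ :=
  (√(2 * Real.pi))⁻¹ * ∫ t in Set.Ioi z, Real.exp (-t ^ 2 / 2)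

/-- The inverse of `gaussianQ`. As `Q` is a strictly decreasing bijection from `ℝ` onto `(0, 1)`,
this is the true inverse at every point of `(0, 1)`. -/
def gaussianQInv (p : ℝ) : ℝ := Function.invFun gaussianQ p

/-- The third absolute central moment of a real random variable. -/
def thirdAbsMoment {Ω : Type*} [MeasurableSpace Ω] (Z : Ω → ℝ) (μ : Measure Ω) : ℝ :=
  ∫ ω, |Z ω - ∫ ω', Z ω' ∂μ| ^ 3 ∂μ

/-- `C` is admissible in the Berry-Esseen theorem for sums of i.i.d. random variables: the
distribution function of a normalized sum of `n` independent copies of a random variable with law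
`μ`, variance `σ² > 0` and third absolute central moment `M < ∞` is uniformly within
`C M / (σ³ √n)` of the standard normal distribution function `1 - Q`. -/
def IsBerryEsseenConstant (C : ℝ) : Prop :=
  ∀ μ : Measure ℝ, IsProbabilityMeasure μ → Integrable (fun x => |x| ^ 3) μ →
    0 < variance (fun x : ℝ => x) μ →
    ∀ n : ℕ, 0 < n → ∀ t : ℝ,
      |(Measure.pi fun _ : Fin n => μ).real
            {s | ∑ i, (s i - ∫ x, x ∂μ) ≤ t * (√(n : ℝ) * √(variance (fun x : ℝ => x) μ))}
          - (1 - gaussianQ t)|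
        ≤ C * thirdAbsMoment (fun x : ℝ => x) μ / (√(n : ℝ) * √(variance (fun x : ℝ => x) μ) ^ 3)

/-- The universal constant `C_BE` of the Berry-Esseen theorem (the best one). -/
def berryEsseenC : ℝ := sInf {C : ℝ | IsBerryEsseenConstant C}

/-- A binary input memoryless channel: conditional densities `p(y|x)`, `x ∈ {0, 1}`, with respect
to a reference measure `dy` on the output alphabet (counting measure for discrete outputs,
Lebesgue measure for continuous outputs). -/
structure BinaryChannel (𝒴 : Type*) [MeasurableSpace 𝒴] where
  /-- the reference measure `dy` -/
  base : Measure 𝒴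
  /-- `p(y|x)` -/
  density : Bool → 𝒴 → ℝ≥0
  measurable_density : ∀ x, Measurable (density x)
  lintegral_density : ∀ x, ∫⁻ y, (density x y : ℝ≥0∞) ∂base = 1

namespace BinaryChannel

variable {𝒴 : Type*} [MeasurableSpace 𝒴] (W : BinaryChannel 𝒴)

/-- The law of the channel output in response to the input letter `x`. -/
def law (x : Bool) : Measure 𝒴 := W.base.withDensity fun y => (W.density x y : ℝ≥0∞)

/-- The law of the output `Y` in response to the uniform input `X`. -/
def outputLaw : Measure 𝒴 :=
  W.base.withDensity fun y => 2⁻¹ * ∑ x : Bool, (W.density x y : ℝ≥0∞)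

/-- The joint law of `(X, Y)`, where `X` is uniform on `{0, 1}`. -/
def joint : Measure (Bool × 𝒴) := ∑ x : Bool, (2⁻¹ : ℝ≥0∞) • (W.law x).map (Prod.mk x)

/-- `p(x|y)`, the conditional probability of `X = x` given `Y = y` for the uniform input `X`. -/
def posterior (x : Bool) (y : 𝒴) : ℝ := (W.density x y : ℝ) / ∑ u : Bool, (W.density u y : ℝ)

/-- The conditional information `-ln p(X|Y)`, as a random variable on the space of `(X, Y)`
(note that `p(X|Y) > 0` almost surely). -/
def info (ω : Bool × 𝒴) : ℝ := -Real.log (W.posterior ω.1 ω.2)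

/-- The symmetry condition: `-ln p(0|Y)` given `X = 0` and `-ln p(1|Y)` given `X = 1` have the same
distribution. -/
def IsSymmetric : Prop :=
  (W.law false).map (fun y => W.info (false, y)) = (W.law true).map (fun y => W.info (true, y))

/-- The mutual information (in nats) between input and output for the input distribution `t`. -/
def mutualInfo (t : Bool → ℝ) : ℝ :=
  ∑ x : Bool, t x *
    ∫ y, (W.density x y : ℝ) *
      Real.log ((W.density x y : ℝ) / ∑ u : Bool, t u * (W.density u y : ℝ)) ∂W.base

/-- The channel capacity in nats. -/
def capacity : ℝ := sSup (W.mutualInfo '' stdSimplex ℝ Bool)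

/-- The conditional entropy `H(X|Y)` in nats, for uniform `X`. -/
def condEntropy : ℝ := ∫ ω, W.info ω ∂W.joint

/-- The set of `λ ≥ 0` with `∑ₓ ∫ p(y) p(x|y)^(1 - λ) dy = E[p(X|Y)^(-λ)] = E[exp(λ(-ln p(X|Y)))]`
finite. -/
def finiteExpSet : Set ℝ := {l | 0 ≤ l ∧ l ∈ integrableExpSet W.info W.joint}

/-- `λ*(X|Y)`, possibly infinite. -/
def lambdaStar : EReal := sSup ((fun l : ℝ => (l : EReal)) '' W.finiteExpSet)

/-- `r_{X|Y}(δ) = sup_{λ ≥ 0} [λ (H(X|Y) + δ) - ln E[p(X|Y)^(-λ)]]`; the `λ` for which the last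
expectation is infinite contribute `-∞` and are left out. -/
def rateFn (δ : ℝ) : ℝ :=
  sSup ((fun l => l * (W.condEntropy + δ) - cgf W.info W.joint l) '' W.finiteExpSet)

/-- The law of `(X_λ, Y_λ)`: density `f_λ(x, y) = p(x|y)^(-λ) / E[p(X|Y)^(-λ)]` with respect to
the joint law of `(X, Y)`. -/
def tiltedJoint (l : ℝ) : Measure (Bool × 𝒴) := W.joint.tilted fun ω => l * W.info ω

/-- `δ(λ) = E[-ln p(X_λ|Y_λ)] - H(X|Y)`. -/
def deltaOf (l : ℝ) : ℝ := (∫ ω, W.info ω ∂W.tiltedJoint l) - W.condEntropy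

/-- `σ_H(X|Y, λ)`, the standard deviation of `-ln p(X_λ|Y_λ)`. -/
def sigmaH (l : ℝ) : ℝ := √(variance W.info (W.tiltedJoint l))

/-- `M_H(X|Y, λ)`, the third absolute central moment of `-ln p(X_λ|Y_λ)`. -/
def momentH (l : ℝ) : ℝ := thirdAbsMoment W.info (W.tiltedJoint l)

/-- `C_BE M_H(X|Y, λ) / (√n σ_H(X|Y, λ)³)`. -/
def berryEsseenTerm (n : ℕ) (l : ℝ) : ℝ :=
  berryEsseenC * W.momentH l / (√(n : ℝ) * W.sigmaH l ^ 3)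

/-- The factor `ξ_H(X|Y, λ, n)` (with a bar below), with `ρ_*` given by
`Q(ρ_*) = 1/2 - 2 C_BE M_H(X|Y, λ) / (√n σ_H(X|Y, λ)³)`. It is meaningful when the right-hand side
is positive. -/
def xiLower (n : ℕ) (l : ℝ) : ℝ :=
  Real.exp (n * l ^ 2 * W.sigmaH l ^ 2 / 2) *
    gaussianQ (gaussianQInv (1 / 2 - 2 * W.berryEsseenTerm n l) + √(n : ℝ) * l * W.sigmaH l)

/-- The law of the output sequence in response to the input sequence `x`. -/
def seqLaw {n : ℕ} (x : Fin n → Bool) : Measure (Fin n → 𝒴) := Measure.pi fun i => W.law (x i)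

/-- The law of `Yⁿ`, the output in response to `n` independent copies of `X`. -/
def outputSeqLaw (n : ℕ) : Measure (Fin n → 𝒴) := Measure.pi fun _ => W.outputLaw

/-- `p(xⁿ|yⁿ)`. -/
def posteriorSeq {n : ℕ} (x : Fin n → Bool) (y : Fin n → 𝒴) : ℝ := ∏ i, W.posterior (x i) (y i)

/-- `-(1/n) ln p(xⁿ|yⁿ)`, for `p(xⁿ|yⁿ) > 0`. -/
def infoSeq {n : ℕ} (x : Fin n → Bool) (y : Fin n → 𝒴) : ℝ :=
  -(1 / (n : ℝ)) * Real.log (W.posteriorSeq x y)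

/-- `Pr{-(1/n) ln p(Xⁿ|Yⁿ) > H(X|Y) + δ}`. -/
def tailProb (n : ℕ) (δ : ℝ) : ℝ :=
  (Measure.pi fun _ : Fin n => W.joint).real
    {ω | W.condEntropy + δ < W.infoSeq (fun i => (ω i).1) (fun i => (ω i).2)}

/-- `B(xⁿ, δ) = {yⁿ : ∞ > -(1/n) ln p(xⁿ|yⁿ) > H(X|Y) + δ}`, the outer mirror image of jar. -/
def outerMirror {n : ℕ} (x : Fin n → Bool) (δ : ℝ) : Set (Fin n → 𝒴) :=
  {y | 0 < W.posteriorSeq x y ∧ W.condEntropy + δ < W.infoSeq x y}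

/-- `B_{n,δ}`, the union of the sets `B(xⁿ, δ)` over all `xⁿ`. -/
def outerUnion (n : ℕ) (δ : ℝ) : Set (Fin n → 𝒴) := ⋃ x : Fin n → Bool, W.outerMirror x δ

/-- `P(B_{n,δ}) = Pr{Yⁿ ∈ B_{n,δ}}`. -/
def probOuterUnion (n : ℕ) (δ : ℝ) : ℝ := (W.outputSeqLaw n).real (W.outerUnion n δ)

/-- `(1 / σ_H(X|Y)) √(-2 ln ε / n)`. -/
def betaTerm (n : ℕ) (ε : ℝ) : ℝ := 1 / W.sigmaH 0 * √(-2 * Real.log ε / n)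

/-- `C - δ - [ln ε + ln ((1 / σ_H) √(-2 ln ε / n)) - ln P(B_{n,δ})] / n`. -/
def converseBound (n : ℕ) (ε δ : ℝ) : ℝ :=
  W.capacity - δ
    - (Real.log ε + Real.log (W.betaTerm n ε) - Real.log (W.probOuterUnion n δ)) / n

/-- `ε + (1/√n) ((√(-2 ln ε) / σ_H) ε + C_BE M_H / σ_H³)`. -/
def normalArg (n : ℕ) (ε : ℝ) : ℝ :=
  ε + 1 / √(n : ℝ) *
    (√(-2 * Real.log ε) / W.sigmaH 0 * ε + berryEsseenC * W.momentH 0 / W.sigmaH 0 ^ 3)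

/-- `C - [ln ε + ln ((1 / σ_H) √(-2 ln ε / n))] / n - (σ_H / √n) Q⁻¹(normalArg n ε)`. -/
def normalBound (n : ℕ) (ε : ℝ) : ℝ :=
  W.capacity - (Real.log ε + Real.log (W.betaTerm n ε)) / n
    - W.sigmaH 0 / √(n : ℝ) * gaussianQInv (W.normalArg n ε)

end BinaryChannel

/-- A channel code of block length `n` for a binary input channel with output alphabet `𝒴`: a
positive number of messages, an encoder, and pairwise disjoint decision regions. Outputs outside of
all decision regions count as errors. -/
structure ChannelCode (𝒴 : Type*) [MeasurableSpace 𝒴] (n : ℕ) where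
  size : ℕ
  size_pos : 0 < size
  encode : Fin size → Fin n → Bool
  region : Fin size → Set (Fin n → 𝒴)
  measurableSet_region : ∀ m, MeasurableSet (region m)
  disjoint_region : Pairwise fun m m' => Disjoint (region m) (region m')

namespace ChannelCode

variable {𝒴 : Type*} [MeasurableSpace 𝒴] {n : ℕ}

/-- The rate, in nats per channel use. -/
def rate (c : ChannelCode 𝒴 n) : ℝ := Real.log c.size / n

/-- The maximum, over all messages, of the word error probability given the message. -/
def maxError (c : ChannelCode 𝒴 n) (W : BinaryChannel 𝒴) : ℝ :=
  ⨆ m, (W.seqLaw (c.encode m)).real (c.region m)ᶜ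

end ChannelCode

end

/-!
The converse rests on a counting argument. Since the channel is symmetric, every codeword `x` sees
its outer mirror image `B(x, δ)` with the same probability, namely the tail probability of
`-(1/n) ln p(Xⁿ|Yⁿ)`. If this is at least `(1 + β) ε`, then at least `β ε` of it falls inside the
decision region of `x`. On `B(x, δ)` the law of the output given `x` has density
`2ⁿ p(x|y) ≤ exp (n (ln 2 - H - δ))` with respect to the unconditional law of the output, and the
parts of the mirror images inside the decision regions are disjoint subsets of `B_{n,δ}`. Summing
over the codewords bounds their number (`BinaryChannel.converse`); the capacity enters only through
`ln 2 - H(X|Y) ≤ C`.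

The two explicit forms come from lower bounds on the tail probability of a sum of `n` independent
copies of `-ln p(X|Y)`. Both need the Berry-Esseen theorem with its best constant, so one has to
know that some constant is admissible (`exists_isBerryEsseenConstant`); the infimum of the
admissible constants is then admissible too. The proof is by Lindeberg replacement and induction on
`n`. Convolve with a Gaussian of variance `v₀` proportional to the square of the third moment, and
exchange the summands for Gaussians one at a time. The exchange that leaves `m` original summands
costs the third moment times the third derivative of the smoothed distribution function. This
derivative is of order `n^(-3/2)` if the `m` summands are replaced by a Gaussian, and the
replacement costs their Kolmogorov distance `D m` from the normal law times a multiple of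
`(v₀ + n - 1 - m)^(-3/2)` (`abs_third_deriv_conv_le`). Summing, and removing the smoothing by
`kolmogorov_le_of_smoothed`, closes the induction once `v₀` is large enough.

The normal approximation form is the Berry-Esseen theorem itself (`gaussianQ_sub_le_tail`). For
`δ = δ(λ)` the law of `-ln p(X|Y)` is tilted by `λ`, so that the threshold becomes the mean. The
factor `exp (-n r(δ))` is the change of measure at the mean, and the remaining integral
`E[exp (-a U); U > 0]` over a nearly normal `U` is compared with the normal one through
distribution functions (`le_setIntegral_exp_neg`, `exponential_tail_lower_bound`).
-/

noncomputable section

/-! ### The standard normal distribution function and its derivatives -/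

/-- The standard normal distribution function. -/
def normalCDF (x : ℝ) : ℝ := (gaussianReal 0 1).real (Set.Iic x)

/-- The standard normal density. -/
def normalPDF (x : ℝ) : ℝ := (√(2 * Real.pi))⁻¹ * Real.exp (-x ^ 2 / 2)

lemma gaussianPDFReal_zero_one : gaussianPDFReal 0 1 = normalPDF := by
  ext x; simp [gaussianPDFReal_def, normalPDF]

lemma continuous_normalPDF : Continuous normalPDF := by unfold normalPDF; fun_prop

lemma integrable_normalPDF : Integrable normalPDF := by
  rw [← gaussianPDFReal_zero_one]; exact integrable_gaussianPDFReal 0 1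

lemma normalPDF_pos (x : ℝ) : 0 < normalPDF x := by unfold normalPDF; positivity

lemma gaussianReal_real_eq_integral (s : Set ℝ) :
    (gaussianReal 0 1).real s = ∫ x in s, normalPDF x := by
  rw [Measure.real, gaussianReal_apply_eq_integral _ one_ne_zero, gaussianPDFReal_zero_one,
    ENNReal.toReal_ofReal]
  exact integral_nonneg fun x => (normalPDF_pos x).le

lemma normalPDF_le_one (x : ℝ) : normalPDF x ≤ 1 := by
  unfold normalPDF
  have h1 : (1 : ℝ) ≤ √(2 * Real.pi) := by
    rw [Real.one_le_sqrt]; nlinarith [Real.pi_gt_three]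
  have h2 : Real.exp (-x ^ 2 / 2) ≤ 1 := Real.exp_le_one_iff.2 (by nlinarith [sq_nonneg x])
  exact mul_le_one₀ (inv_le_one_of_one_le₀ h1) (Real.exp_pos _).le h2

lemma hasDerivAt_normalPDF (x : ℝ) : HasDerivAt normalPDF (-x * normalPDF x) x := by
  unfold normalPDF
  have h : HasDerivAt (fun x : ℝ => -x ^ 2 / 2) (-x) x := by
    refine ((hasDerivAt_pow 2 x).neg.div_const 2).congr_deriv ?_
    simp; ring
  refine (h.exp.const_mul (√(2 * Real.pi))⁻¹).congr_deriv ?_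
  ring

lemma hasDerivAt_normalCDF (x : ℝ) : HasDerivAt normalCDF (normalPDF x) x := by
  have h1 : normalCDF = fun y => normalCDF 0 + ∫ t in (0 : ℝ)..y, normalPDF t := by
    ext y
    rw [← intervalIntegral.integral_Iic_sub_Iic integrable_normalPDF.integrableOn
      integrable_normalPDF.integrableOn]
    simp only [normalCDF, gaussianReal_real_eq_integral]
    ring
  rw [h1]
  exact (intervalIntegral.integral_hasDerivAt_right
    (continuous_normalPDF.intervalIntegrable _ _)
    (continuous_normalPDF.stronglyMeasurableAtFilter _ _) continuous_normalPDF.continuousAt).const_add _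

/-- The derivative of the standard normal density. -/
def normalPDF1 (x : ℝ) : ℝ := -x * normalPDF x

/-- The second derivative of the standard normal density. -/
def normalPDF2 (x : ℝ) : ℝ := (x ^ 2 - 1) * normalPDF x

/-- The third derivative of the standard normal density. -/
def normalPDF3 (x : ℝ) : ℝ := (3 * x - x ^ 3) * normalPDF x

lemma hasDerivAt_normalPDF1 (x : ℝ) : HasDerivAt normalPDF1 (normalPDF2 x) x := by
  refine ((hasDerivAt_id x).neg.mul (hasDerivAt_normalPDF x)).congr_deriv ?_
  simp [normalPDF2]; ring

lemma hasDerivAt_normalPDF2 (x : ℝ) : HasDerivAt normalPDF2 (normalPDF3 x) x := by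
  refine (((hasDerivAt_pow 2 x).sub_const 1).mul (hasDerivAt_normalPDF x)).congr_deriv ?_
  simp [normalPDF3]; ring

lemma integrable_pow_mul_normalPDF (k : ℕ) : Integrable fun x : ℝ => x ^ k * normalPDF x := by
  have h : Integrable fun x : ℝ => x ^ (k : ℝ) * Real.exp (-(1 / 2) * x ^ 2) :=
    integrable_rpow_mul_exp_neg_mul_sq (by norm_num) (by
      have : (0 : ℝ) ≤ k := k.cast_nonneg
      linarith)
  refine (h.const_mul (√(2 * Real.pi))⁻¹).congr (Eventually.of_forall fun x => ?_)
  simp only [normalPDF, Real.rpow_natCast]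
  rw [show -(1 / 2) * x ^ 2 = -x ^ 2 / 2 by ring]; ring

lemma integrable_normalPDF3 : Integrable normalPDF3 := by
  refine (((integrable_pow_mul_normalPDF 1).const_mul 3).sub
    (integrable_pow_mul_normalPDF 3)).congr (Eventually.of_forall fun x => ?_)
  simp [normalPDF3]; ring

lemma sq_mul_normalPDF_le (x : ℝ) : x ^ 2 * normalPDF x ≤ 2 := by
  unfold normalPDF
  have h1 : (1 : ℝ) ≤ √(2 * Real.pi) := by
    rw [Real.one_le_sqrt]; nlinarith [Real.pi_gt_three]
  have h2 : x ^ 2 * Real.exp (-x ^ 2 / 2) ≤ 2 := by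
    have := Real.add_one_le_exp (x ^ 2 / 2)
    have h3 : Real.exp (x ^ 2 / 2) * Real.exp (-x ^ 2 / 2) = 1 := by
      rw [← Real.exp_add]; simp [neg_div]
    nlinarith [Real.exp_pos (-x ^ 2 / 2)]
  have h3 : (√(2 * Real.pi))⁻¹ ≤ 1 := inv_le_one_of_one_le₀ h1
  have h4 : 0 ≤ x ^ 2 * Real.exp (-x ^ 2 / 2) := by positivity
  calc _ = (√(2 * Real.pi))⁻¹ * (x ^ 2 * Real.exp (-x ^ 2 / 2)) := by ring
    _ ≤ 1 * (x ^ 2 * Real.exp (-x ^ 2 / 2)) := by gcongr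
    _ ≤ 2 := by linarith

lemma abs_normalPDF1_le (x : ℝ) : |normalPDF1 x| ≤ 3 := by
  have h0 := normalPDF_pos x
  have h1 := normalPDF_le_one x
  have h2 := sq_mul_normalPDF_le x
  rw [normalPDF1, abs_mul, abs_neg, abs_of_pos h0]
  nlinarith [mul_nonneg (sq_nonneg (|x| - 1)) h0.le, sq_abs x]

lemma abs_normalPDF2_le (x : ℝ) : |normalPDF2 x| ≤ 3 := by
  have h0 := normalPDF_pos x
  have h1 := normalPDF_le_one x
  have h2 := sq_mul_normalPDF_le x
  rw [normalPDF2, abs_le]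
  constructor <;> nlinarith [sq_nonneg x, mul_nonneg (sq_nonneg x) h0.le]

lemma abs_normalCDF_le (x : ℝ) : |normalCDF x| ≤ 1 := by
  rw [normalCDF, abs_of_nonneg measureReal_nonneg]
  exact measureReal_le_one

lemma continuous_normalPDF1 : Continuous normalPDF1 :=
  continuous_iff_continuousAt.2 fun x => (hasDerivAt_normalPDF1 x).continuousAt

lemma continuous_normalPDF2 : Continuous normalPDF2 :=
  continuous_iff_continuousAt.2 fun x => (hasDerivAt_normalPDF2 x).continuousAt

lemma continuous_normalCDF : Continuous normalCDF :=
  continuous_iff_continuousAt.2 fun x => (hasDerivAt_normalCDF x).continuousAt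

lemma tendsto_normalPDF2_atBot : Tendsto normalPDF2 atBot (nhds 0) := by
  have hint : Integrable normalPDF2 := by
    refine ((integrable_pow_mul_normalPDF 2).sub (integrable_pow_mul_normalPDF 0)).congr
      (Eventually.of_forall fun x => ?_)
    simp [normalPDF2]; ring
  exact tendsto_zero_of_hasDerivAt_of_integrableOn_Iic (a := 0)
    (fun x _ => hasDerivAt_normalPDF2 x)
    integrable_normalPDF3.integrableOn hint.integrableOn

lemma normalPDF2_eq_integral (x : ℝ) : normalPDF2 x = ∫ u in Set.Iic x, normalPDF3 u := by
  rw [integral_Iic_of_hasDerivAt_of_tendsto' (fun y _ => hasDerivAt_normalPDF2 y)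
    integrable_normalPDF3.integrableOn tendsto_normalPDF2_atBot, sub_zero]

/-- The distribution function of a centred Gaussian. -/
lemma gaussianReal_real_Iic {v : ℝ≥0} (hv : v ≠ 0) (x : ℝ) :
    (gaussianReal 0 v).real (Set.Iic x) = normalCDF (x / √(v : ℝ)) := by
  have hs : 0 < √(v : ℝ) := Real.sqrt_pos.2 (by positivity)
  have h : gaussianReal 0 v = (gaussianReal 0 1).map (√(v : ℝ) * ·) := by
    rw [gaussianReal_map_const_mul]
    congr 1
    · simp
    · ext; simp
  rw [h, map_measureReal_apply (by fun_prop) measurableSet_Iic, normalCDF]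
  congr 1
  ext y
  simp [le_div_iff₀ hs, mul_comm]

/-- The distribution function of a convolution. -/
lemma conv_real_Iic (μ ν : Measure ℝ) [IsProbabilityMeasure μ] [IsProbabilityMeasure ν] (a : ℝ) :
    (μ ∗ ν).real (Set.Iic a) = ∫ x, ν.real (Set.Iic (a - x)) ∂μ := by
  rw [← integral_indicator_one measurableSet_Iic, integral_conv]
  · congr 1 with x
    rw [← integral_indicator_one measurableSet_Iic]
    congr 1 with y
    simp [Set.indicator, le_sub_iff_add_le, add_comm]
  · exact (integrable_const 1).indicator measurableSet_Iic

/-- Differentiation of a smoothed function. -/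
lemma hasDerivAt_integral_comp_sub_div (ν : Measure ℝ) [IsProbabilityMeasure ν] {g g' : ℝ → ℝ}
    {C C' s : ℝ} (hg : ∀ x, HasDerivAt g (g' x) x) (hg' : Continuous g')
    (hC : ∀ x, |g x| ≤ C) (hC' : ∀ x, |g' x| ≤ C') (a : ℝ) :
    HasDerivAt (fun a => ∫ x, g ((a - x) / s) ∂ν) (s⁻¹ * ∫ x, g' ((a - x) / s) ∂ν) a := by
  have hgc : Continuous g := continuous_iff_continuousAt.2 fun x => (hg x).continuousAt
  have h := (hasDerivAt_integral_of_dominated_loc_of_deriv_le (μ := ν) (𝕜 := ℝ)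
    (F := fun a x => g ((a - x) / s)) (F' := fun a x => s⁻¹ * g' ((a - x) / s))
    (bound := fun _ => |s⁻¹| * C') (s := Set.univ) (x₀ := a) univ_mem
    (Eventually.of_forall fun a => by
      apply Continuous.aestronglyMeasurable; fun_prop)
    (Integrable.of_bound (C := C) (by apply Continuous.aestronglyMeasurable; fun_prop)
      (Eventually.of_forall fun x => hC _))
    (by apply Continuous.aestronglyMeasurable; fun_prop)
    (Eventually.of_forall fun x b _ => by
      rw [Real.norm_eq_abs, abs_mul]
      exact mul_le_mul_of_nonneg_left (hC' _) (abs_nonneg _))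
    (integrable_const _)
    (Eventually.of_forall fun x b _ => by
      have h1 : HasDerivAt (fun b : ℝ => (b - x) / s) (1 / s) b :=
        ((hasDerivAt_id b).sub_const x).div_const s
      refine ((hg ((b - x) / s)).comp b h1).congr_deriv ?_
      ring)).2
  rwa [integral_const_mul] at h

/-! ### Lindeberg replacement for smoothed distribution functions -/

/-- Integrating an absolutely continuous function, vanishing at `-∞`, against two laws: the
difference is at most the Kolmogorov distance times the total variation of the function. -/
lemma abs_integral_sub_le_of_kolmogorov (μ ν : Measure ℝ) [IsProbabilityMeasure μ]
    [IsProbabilityMeasure ν] {g g' : ℝ → ℝ} {D s : ℝ} (hs : 0 < s) (a : ℝ)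
    (hg' : Integrable g') (hg : ∀ x, g x = ∫ u in Set.Iic x, g' u)
    (hD : ∀ t, |μ.real (Set.Iic t) - ν.real (Set.Iic t)| ≤ D) :
    |(∫ x, g ((a - x) / s) ∂μ) - ∫ x, g ((a - x) / s) ∂ν| ≤ D * ∫ u, |g' u| := by
  have hset : MeasurableSet {p : ℝ × ℝ | p.1 ≤ a - s * p.2} :=
    measurableSet_le measurable_fst (by fun_prop)
  have key : ∀ κ : Measure ℝ, IsProbabilityMeasure κ →
      ∫ x, g ((a - x) / s) ∂κ = ∫ u, g' u * κ.real (Set.Iic (a - s * u)) := by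
    intro κ _
    have h1 : ∀ x, g ((a - x) / s)
        = ∫ u, Set.indicator {p : ℝ × ℝ | p.1 ≤ a - s * p.2} (fun p => g' p.2) (x, u) := by
      intro x
      rw [hg, ← integral_indicator measurableSet_Iic]
      congr 1 with u
      simp only [Set.indicator, Set.mem_Iic, Set.mem_ofPred_eq, le_div_iff₀ hs]
      congr 1
      rw [eq_iff_iff]
      constructor <;> intro h <;> linarith
    simp_rw [h1]
    rw [integral_integral_swap]
    · congr 1 with u
      have h2 : ∀ x, Set.indicator {p : ℝ × ℝ | p.1 ≤ a - s * p.2} (fun p => g' p.2) (x, u)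
          = g' u * (Set.Iic (a - s * u)).indicator 1 x := by
        intro x
        simp [Set.indicator]
      simp_rw [h2]
      rw [integral_const_mul, integral_indicator_one measurableSet_Iic]
    · exact (hg'.comp_snd κ).indicator hset
  have hint : ∀ κ : Measure ℝ, IsProbabilityMeasure κ →
      Integrable fun u => g' u * κ.real (Set.Iic (a - s * u)) := by
    intro κ _
    refine hg'.mul_bdd (c := 1) ?_ (Eventually.of_forall fun u => ?_)
    · have hm : Monotone fun t => κ.real (Set.Iic t) := fun x y h =>
        measureReal_mono (Set.Iic_subset_Iic.2 h)
      exact (hm.measurable.comp (by fun_prop : Measurable fun u : ℝ => a - s * u)).aestronglyMeasurable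
    · rw [Real.norm_eq_abs, abs_of_nonneg measureReal_nonneg]
      exact measureReal_le_one
  rw [key μ inferInstance, key ν inferInstance,
    ← integral_sub (hint μ inferInstance) (hint ν inferInstance), ← integral_const_mul]
  refine (abs_integral_le_integral_abs).trans (integral_mono
    ((hint μ inferInstance).sub (hint ν inferInstance)).abs (hg'.abs.const_mul D) fun u => ?_)
  simp only
  rw [← mul_sub, abs_mul, mul_comm]
  exact mul_le_mul_of_nonneg_right (hD _) (abs_nonneg _)

/-- The distribution function of `ν ∗ N(0, v)` is three times differentiable. -/
lemma exists_deriv_conv_gaussian (ν : Measure ℝ) [IsProbabilityMeasure ν] {v : ℝ≥0} (hv : v ≠ 0) :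
    (∀ a, HasDerivAt (fun a => (ν ∗ gaussianReal 0 v).real (Set.Iic a))
      ((√(v : ℝ))⁻¹ * ∫ x, normalPDF ((a - x) / √(v : ℝ)) ∂ν) a) ∧
    (∀ a, HasDerivAt (fun a => (√(v : ℝ))⁻¹ * ∫ x, normalPDF ((a - x) / √(v : ℝ)) ∂ν)
      ((√(v : ℝ))⁻¹ ^ 2 * ∫ x, normalPDF1 ((a - x) / √(v : ℝ)) ∂ν) a) ∧
    (∀ a, HasDerivAt (fun a => (√(v : ℝ))⁻¹ ^ 2 * ∫ x, normalPDF1 ((a - x) / √(v : ℝ)) ∂ν)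
      ((√(v : ℝ))⁻¹ ^ 3 * ∫ x, normalPDF2 ((a - x) / √(v : ℝ)) ∂ν) a) := by
  refine ⟨fun a => ?_, fun a => ?_, fun a => ?_⟩
  · simp_rw [conv_real_Iic, gaussianReal_real_Iic hv]
    exact hasDerivAt_integral_comp_sub_div ν hasDerivAt_normalCDF continuous_normalPDF
      abs_normalCDF_le (fun x => by rw [abs_of_pos (normalPDF_pos x)]; exact normalPDF_le_one x) a
  · refine ((hasDerivAt_integral_comp_sub_div ν hasDerivAt_normalPDF continuous_normalPDF1
      (fun x => by rw [abs_of_pos (normalPDF_pos x)]; exact normalPDF_le_one x)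
      abs_normalPDF1_le a).const_mul _).congr_deriv ?_
    rw [← mul_assoc, sq]; rfl
  · refine ((hasDerivAt_integral_comp_sub_div ν hasDerivAt_normalPDF1 continuous_normalPDF2
      abs_normalPDF1_le abs_normalPDF2_le a).const_mul _).congr_deriv ?_
    rw [← mul_assoc, pow_succ _ 2]

/-- Averaging the scaled second derivative of the normal density over a Gaussian. -/
lemma integral_normalPDF2_gaussianReal {v : ℝ≥0} (hv : v ≠ 0) (w : ℝ≥0) (a : ℝ) :
    (√(v : ℝ))⁻¹ ^ 3 * ∫ x, normalPDF2 ((a - x) / √(v : ℝ)) ∂(gaussianReal 0 w)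
      = (√((v + w : ℝ≥0) : ℝ))⁻¹ ^ 3 * normalPDF2 (a / √((v + w : ℝ≥0) : ℝ)) := by
  have hvw : v + w ≠ 0 := by simp [hv]
  obtain ⟨h1, h2, h3⟩ := exists_deriv_conv_gaussian (gaussianReal 0 w) hv
  obtain ⟨k1, k2, k3⟩ := exists_deriv_conv_gaussian (Measure.dirac (0 : ℝ)) hvw
  have e : gaussianReal 0 w ∗ gaussianReal 0 v = Measure.dirac (0 : ℝ) ∗ gaussianReal 0 (v + w) := by
    rw [gaussianReal_conv_gaussianReal, Measure.dirac_zero_conv, add_zero, add_comm]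
  rw [e] at h1
  have e1 := funext fun a => (h1 a).unique (k1 a)
  rw [e1] at h2
  have e2 := funext fun a => (h2 a).unique (k2 a)
  rw [e2] at h3
  have e3 := (h3 a).unique (k3 a)
  rw [e3]
  simp

/-- The third derivative of the distribution function of `ν ∗ N(0, v)`, for `ν` within Kolmogorov
distance `D` of `N(0, w)`. -/
lemma abs_third_deriv_conv_le (ν : Measure ℝ) [IsProbabilityMeasure ν] {v : ℝ≥0} (hv : v ≠ 0)
    (w : ℝ≥0) {D : ℝ} (hD : ∀ t, |ν.real (Set.Iic t) - (gaussianReal 0 w).real (Set.Iic t)| ≤ D)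
    (a : ℝ) :
    |(√(v : ℝ))⁻¹ ^ 3 * ∫ x, normalPDF2 ((a - x) / √(v : ℝ)) ∂ν|
      ≤ 3 * (√((v + w : ℝ≥0) : ℝ))⁻¹ ^ 3
        + D * (∫ u, |normalPDF3 u|) * (√(v : ℝ))⁻¹ ^ 3 := by
  have hs : 0 < √(v : ℝ) := Real.sqrt_pos.2 (by positivity)
  have h1 := abs_integral_sub_le_of_kolmogorov ν (gaussianReal 0 w) hs a integrable_normalPDF3
    normalPDF2_eq_integral hD
  have h2 := integral_normalPDF2_gaussianReal hv w a
  have h3 := abs_normalPDF2_le (a / √((v + w : ℝ≥0) : ℝ))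
  have h4 : 0 ≤ (√((v + w : ℝ≥0) : ℝ))⁻¹ ^ 3 := by positivity
  have h5 : 0 ≤ (√(v : ℝ))⁻¹ ^ 3 := by positivity
  set I := ∫ x, normalPDF2 ((a - x) / √(v : ℝ)) ∂ν
  set J := ∫ x, normalPDF2 ((a - x) / √(v : ℝ)) ∂(gaussianReal 0 w)
  calc _ = |(√(v : ℝ))⁻¹ ^ 3 * J + (√(v : ℝ))⁻¹ ^ 3 * (I - J)| := by ring_nf
    _ ≤ |(√(v : ℝ))⁻¹ ^ 3 * J| + |(√(v : ℝ))⁻¹ ^ 3 * (I - J)| := abs_add_le _ _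
    _ ≤ (√((v + w : ℝ≥0) : ℝ))⁻¹ ^ 3 * 3
        + (√(v : ℝ))⁻¹ ^ 3 * (D * (∫ u, |normalPDF3 u|)) := by
      rw [h2, abs_mul, abs_mul, abs_of_nonneg h4, abs_of_nonneg h5]
      gcongr
    _ = _ := by ring

/-- A second order Taylor estimate. -/
lemma abs_taylor_two_le {F F1 F2 F3 : ℝ → ℝ} {B : ℝ} (h1 : ∀ x, HasDerivAt F (F1 x) x)
    (h2 : ∀ x, HasDerivAt F1 (F2 x) x) (h3 : ∀ x, HasDerivAt F2 (F3 x) x)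
    (hB : ∀ x, |F3 x| ≤ B) (t x : ℝ) :
    |F (t + x) - (F t + x * F1 t + x ^ 2 / 2 * F2 t)| ≤ B * |x| ^ 3 := by
  have hB0 : 0 ≤ B := (abs_nonneg _).trans (hB 0)
  have mem : ∀ y ∈ Set.uIcc 0 x, |y| ≤ |x| := fun y hy => by
    simpa using Set.abs_sub_left_of_mem_uIcc hy
  have l0 : (0 : ℝ) ∈ Set.uIcc 0 x := Set.left_mem_uIcc
  have a2 : ∀ y, |F2 (t + y) - F2 t| ≤ B * |y| := by
    intro y
    have := convex_univ.norm_image_sub_le_of_norm_hasDerivWithin_le (f := F2) (f' := F3) (C := B)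
      (fun z _ => (h3 z).hasDerivWithinAt) (fun z _ => hB z) (Set.mem_univ t)
      (Set.mem_univ (t + y))
    simpa using this
  have a1 : ∀ y ∈ Set.uIcc 0 x, |F1 (t + y) - (F1 t + y * F2 t)| ≤ B * |x| * |y| := by
    intro y hy
    have := (convex_uIcc (0 : ℝ) x).norm_image_sub_le_of_norm_hasDerivWithin_le
      (f := fun y => F1 (t + y) - (F1 t + y * F2 t)) (f' := fun y => F2 (t + y) - F2 t)
      (C := B * |x|) (fun z _ => HasDerivAt.hasDerivWithinAt (by
        have e1 := (h2 (t + z)).comp_const_add t z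
        have e2 := ((hasDerivAt_id z).mul_const (F2 t)).const_add (F1 t)
        refine (e1.sub e2).congr_deriv (by simp)))
      (fun z hz => (a2 z).trans (mul_le_mul_of_nonneg_left (mem z hz) hB0)) l0 hy
    simpa using this
  have := (convex_uIcc (0 : ℝ) x).norm_image_sub_le_of_norm_hasDerivWithin_le
      (f := fun y => F (t + y) - (F t + y * F1 t + y ^ 2 / 2 * F2 t))
      (f' := fun y => F1 (t + y) - (F1 t + y * F2 t))
      (C := B * |x| * |x|) (fun z _ => HasDerivAt.hasDerivWithinAt (by
        have e1 := (h1 (t + z)).comp_const_add t z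
        have e2 := (((hasDerivAt_id z).mul_const (F1 t)).const_add (F t)).add
          (((hasDerivAt_pow 2 z).div_const 2).mul_const (F2 t))
        refine (e1.sub e2).congr_deriv (by simp)))
      (fun z hz => (a1 z hz).trans (mul_le_mul_of_nonneg_left (mem z hz) (by positivity)))
      l0 (Set.right_mem_uIcc)
  simp only [add_zero, zero_mul, sub_zero] at this
  calc _ ≤ _ := by simpa using this
    _ = _ := by ring

/-- Lindeberg replacement: laws with the same first two moments are nearly interchangeable. -/
lemma abs_integral_comp_sub_sub_le {F F1 F2 F3 : ℝ → ℝ} {B : ℝ}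
    (h1 : ∀ x, HasDerivAt F (F1 x) x)
    (h2 : ∀ x, HasDerivAt F1 (F2 x) x) (h3 : ∀ x, HasDerivAt F2 (F3 x) x)
    (hB : ∀ x, |F3 x| ≤ B) {C : ℝ} (hC : ∀ x, |F x| ≤ C) (μ ν : Measure ℝ)
    [IsProbabilityMeasure μ] [IsProbabilityMeasure ν]
    (hμ1 : Integrable (fun x => x) μ) (hμ2 : Integrable (fun x => x ^ 2) μ)
    (hμ3 : Integrable (fun x => |x| ^ 3) μ)
    (hν1 : Integrable (fun x => x) ν) (hν2 : Integrable (fun x => x ^ 2) ν)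
    (hν3 : Integrable (fun x => |x| ^ 3) ν)
    (e1 : ∫ x, x ∂μ = ∫ x, x ∂ν) (e2 : ∫ x, x ^ 2 ∂μ = ∫ x, x ^ 2 ∂ν) (t : ℝ) :
    |(∫ x, F (t - x) ∂μ) - ∫ x, F (t - x) ∂ν| ≤ B * ((∫ x, |x| ^ 3 ∂μ) + ∫ x, |x| ^ 3 ∂ν) := by
  have hF : Continuous F := continuous_iff_continuousAt.2 fun x => (h1 x).continuousAt
  have key : ∀ κ : Measure ℝ, IsProbabilityMeasure κ → Integrable (fun x => x) κ →
      Integrable (fun x => x ^ 2) κ → Integrable (fun x => |x| ^ 3) κ →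
      |(∫ x, F (t - x) ∂κ) - (F t - (∫ x, x ∂κ) * F1 t + (∫ x, x ^ 2 ∂κ) / 2 * F2 t)|
        ≤ B * ∫ x, |x| ^ 3 ∂κ := by
    intro κ _ k1 k2 k3
    have i0 : Integrable (fun x => F (t - x)) κ := Integrable.of_bound (C := C)
      (by apply Continuous.aestronglyMeasurable; fun_prop) (Eventually.of_forall fun x => hC _)
    have i1 : Integrable (fun x => F t - x * F1 t) κ := (integrable_const _).sub (k1.mul_const _)
    have i2 : Integrable (fun x => x ^ 2 / 2 * F2 t) κ := (k2.div_const 2).mul_const _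
    have i12 : Integrable (fun x => F t - x * F1 t + x ^ 2 / 2 * F2 t) κ := i1.add i2
    have e : (∫ x, F (t - x) ∂κ) - (F t - (∫ x, x ∂κ) * F1 t + (∫ x, x ^ 2 ∂κ) / 2 * F2 t)
        = ∫ x, (F (t - x) - (F t - x * F1 t + x ^ 2 / 2 * F2 t)) ∂κ := by
      rw [integral_sub i0 i12, integral_add i1 i2,
        integral_sub (integrable_const _) (k1.mul_const _), integral_mul_const,
        integral_mul_const, integral_div]
      simp
    rw [e, ← integral_const_mul]
    refine abs_integral_le_integral_abs.trans
      (integral_mono (i0.sub i12).abs (k3.const_mul B) fun x => ?_)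
    have := abs_taylor_two_le h1 h2 h3 hB t (-x)
    simp only
    rw [abs_neg] at this
    calc _ = |F (t + -x) - (F t + -x * F1 t + (-x) ^ 2 / 2 * F2 t)| := by ring_nf
      _ ≤ _ := this
  have kμ := key μ inferInstance hμ1 hμ2 hμ3
  have kν := key ν inferInstance hν1 hν2 hν3
  rw [e1, e2] at kμ
  rw [abs_le] at *
  constructor <;> linarith [kμ.1, kμ.2, kν.1, kν.2]

/-! ### Gaussian smoothing and sums of independent variables -/

/-- A function that is at least `-D` everywhere, and at least `c` on an interval of probability
`3/4`, has integral at least `3/4 c - 1/4 D`. -/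
lemma le_integral_of_le_near_zero (η : Measure ℝ) [IsProbabilityMeasure η] {f : ℝ → ℝ}
    (hf : Integrable f η) {D c h : ℝ} (hD : ∀ z, -D ≤ f z) (hc : ∀ z, |z| < h → c ≤ f z)
    (hcD : -D ≤ c) (hη : 3 / 4 ≤ η.real {z | |z| < h}) :
    3 / 4 * (c + D) - D ≤ ∫ z, f z ∂η := by
  have hm : MeasurableSet {z : ℝ | |z| < h} := measurableSet_lt (by fun_prop) measurable_const
  have h0 : Integrable (fun z => (c + D) * Set.indicator {z | |z| < h} 1 z) η :=
    ((integrable_const (1 : ℝ)).indicator hm).const_mul _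
  have h1 : Integrable (fun z => -D + (c + D) * Set.indicator {z | |z| < h} 1 z) η :=
    (integrable_const _).add h0
  have h2 : ∫ z, (-D + (c + D) * Set.indicator {z | |z| < h} 1 z) ∂η
      = -D + (c + D) * η.real {z | |z| < h} := by
    rw [integral_add (integrable_const _) h0, integral_const_mul, integral_indicator_one hm]
    simp
  have h3 := integral_mono h1 hf fun z => by
    by_cases hz : |z| < h
    · simpa [Set.indicator, hz] using hc z hz
    · simpa [Set.indicator, hz] using hD z
  rw [h2] at h3
  nlinarith

/-- Chebyshev's inequality at two standard deviations. -/
lemma three_quarters_le_gaussianReal {v : ℝ≥0} (hv : v ≠ 0) :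
    3 / 4 ≤ (gaussianReal 0 v).real {z | |z| < 2 * √(v : ℝ)} := by
  have hs : 0 < √(v : ℝ) := Real.sqrt_pos.2 (by positivity)
  have h := meas_ge_le_variance_div_sq (memLp_id_gaussianReal (μ := 0) (v := v) 2)
    (c := 2 * √(v : ℝ)) (by positivity)
  rw [variance_id_gaussianReal] at h
  simp only [id_eq, integral_id_gaussianReal, sub_zero] at h
  have e : (v : ℝ) / (2 * √(v : ℝ)) ^ 2 = 1 / 4 := by
    rw [mul_pow, Real.sq_sqrt v.coe_nonneg]
    have : (v : ℝ) ≠ 0 := by exact_mod_cast hv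
    field_simp; norm_num
  rw [e] at h
  have h' : (gaussianReal 0 v).real {z | 2 * √(v : ℝ) ≤ |z|} ≤ 1 / 4 :=
    ENNReal.toReal_le_of_le_ofReal (by norm_num) h
  have hm : MeasurableSet {z : ℝ | |z| < 2 * √(v : ℝ)} :=
    measurableSet_lt (by fun_prop) measurable_const
  have hc := probReal_compl_eq_one_sub (μ := gaussianReal 0 v) hm
  have : {z : ℝ | |z| < 2 * √(v : ℝ)}ᶜ = {z | 2 * √(v : ℝ) ≤ |z|} := by ext; simp
  rw [this] at hc
  linarith

lemma integrable_real_Iic_sub (μ η : Measure ℝ) [IsProbabilityMeasure μ] [IsProbabilityMeasure η]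
    (a : ℝ) : Integrable (fun z => μ.real (Set.Iic (a - z))) η := by
  have hm : Monotone fun t => μ.real (Set.Iic t) := fun x y h =>
    measureReal_mono (Set.Iic_subset_Iic.2 h)
  refine Integrable.of_bound (C := 1)
    (hm.measurable.comp (by fun_prop : Measurable fun u : ℝ => a - u)).aestronglyMeasurable
    (Eventually.of_forall fun z => ?_)
  rw [Real.norm_eq_abs, abs_of_nonneg measureReal_nonneg]
  exact measureReal_le_one

/-- Smoothing inequality: the Kolmogorov distance from a law with a Lipschitz distribution function
is controlled by the distance after convolution of both laws with a Gaussian. -/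
lemma kolmogorov_le_of_smoothed (ν G : Measure ℝ) [IsProbabilityMeasure ν]
    [IsProbabilityMeasure G] {L E : ℝ} {v : ℝ≥0} (hv : v ≠ 0)
    (hL : ∀ t y, 0 ≤ y → G.real (Set.Iic (t + y)) ≤ G.real (Set.Iic t) + L * y)
    (hE : ∀ t, |(ν ∗ gaussianReal 0 v).real (Set.Iic t) - (G ∗ gaussianReal 0 v).real (Set.Iic t)|
      ≤ E) (t : ℝ) :
    |ν.real (Set.Iic t) - G.real (Set.Iic t)| ≤ 2 * E + 6 * L * √(v : ℝ) := by
  have hs : 0 < √(v : ℝ) := Real.sqrt_pos.2 (by positivity)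
  have hq := three_quarters_le_gaussianReal hv
  have hE0 : 0 ≤ E := (abs_nonneg _).trans (hE 0)
  have hL0 : 0 ≤ L := by
    have := hL 0 1 zero_le_one
    have h2 : G.real (Set.Iic 0) ≤ G.real (Set.Iic (0 + 1)) :=
      measureReal_mono (Set.Iic_subset_Iic.2 (by norm_num))
    linarith
  set H : ℝ → ℝ := fun t => ν.real (Set.Iic t) - G.real (Set.Iic t) with hH
  have hνm : ∀ x y, x ≤ y → ν.real (Set.Iic x) ≤ ν.real (Set.Iic y) := fun x y h =>
    measureReal_mono (Set.Iic_subset_Iic.2 h)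
  have hH1 : ∀ t, |H t| ≤ 1 := fun t => by
    have h1 : ν.real (Set.Iic t) ≤ 1 := measureReal_le_one
    have h2 : G.real (Set.Iic t) ≤ 1 := measureReal_le_one
    have h3 : 0 ≤ ν.real (Set.Iic t) := measureReal_nonneg
    have h4 : 0 ≤ G.real (Set.Iic t) := measureReal_nonneg
    rw [abs_le]; constructor <;> simp only [hH] <;> linarith
  have hbdd : BddAbove (Set.range fun t => |H t|) := ⟨1, by rintro _ ⟨t, rfl⟩; exact hH1 t⟩
  set D := ⨆ t, |H t| with hDdef
  have hD : ∀ t, |H t| ≤ D := fun t => le_ciSup hbdd t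
  have hint : ∀ a, Integrable (fun z => H (a - z)) (gaussianReal 0 v) := fun a =>
    (integrable_real_Iic_sub ν _ a).sub (integrable_real_Iic_sub G _ a)
  have hconv : ∀ a, |∫ z, H (a - z) ∂(gaussianReal 0 v)| ≤ E := fun a => by
    have e : ∫ z, H (a - z) ∂(gaussianReal 0 v) = (ν ∗ gaussianReal 0 v).real (Set.Iic a)
        - (G ∗ gaussianReal 0 v).real (Set.Iic a) := by
      rw [Measure.conv_comm ν, Measure.conv_comm G, conv_real_Iic, conv_real_Iic,
        ← integral_sub (integrable_real_Iic_sub ν _ a) (integrable_real_Iic_sub G _ a)]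
    rw [e]; exact hE a
  have step : ∀ τ, 0 < τ → D ≤ 2 * E + 6 * L * √(v : ℝ) + 3 / 2 * τ := by
    intro τ hτ
    obtain ⟨t0, ht0⟩ := exists_lt_of_lt_ciSup (show D - τ < ⨆ t, |H t| by linarith)
    by_contra! hcon
    have hLs : 0 ≤ L * √(v : ℝ) := by positivity
    have hcD : -D ≤ D - τ - L * (4 * √(v : ℝ)) := by nlinarith
    -- `H` is nearly extremal at `t0`, and since `ν` has a monotone and `G` a Lipschitz distribution
    -- function it stays so on a one-sided interval; average `H` over that interval
    rcases le_abs.1 ht0.le with h | h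
    · have k := le_integral_of_le_near_zero (gaussianReal 0 v)
        (hint (t0 + 2 * √(v : ℝ))) (D := D) (c := D - τ - L * (4 * √(v : ℝ)))
        (h := 2 * √(v : ℝ)) (fun z => (abs_le.1 (hD _)).1) (fun z hz => ?_) hcD hq
      · have := (abs_le.1 (hconv (t0 + 2 * √(v : ℝ)))).2
        nlinarith
      · have hz' := abs_lt.1 hz
        have l1 := hL t0 (2 * √(v : ℝ) - z) (by linarith)
        have l2 := hνm t0 (t0 + (2 * √(v : ℝ) - z)) (by linarith)
        have l3 : L * (2 * √(v : ℝ) - z) ≤ L * (4 * √(v : ℝ)) :=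
          mul_le_mul_of_nonneg_left (by linarith) hL0
        simp only [hH] at h ⊢
        rw [add_sub_assoc]
        linarith
    · have k := le_integral_of_le_near_zero (gaussianReal 0 v)
        (hint (t0 - 2 * √(v : ℝ))).neg (D := D) (c := D - τ - L * (4 * √(v : ℝ)))
        (h := 2 * √(v : ℝ)) (fun z => neg_le_neg (abs_le.1 (hD _)).2) (fun z hz => ?_) hcD hq
      · have := (abs_le.1 (hconv (t0 - 2 * √(v : ℝ)))).1
        simp only [Pi.neg_apply] at k
        rw [integral_neg] at k
        nlinarith
      · have hz' := abs_lt.1 hz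
        have l1 := hL (t0 - 2 * √(v : ℝ) - z) (2 * √(v : ℝ) + z) (by linarith)
        have l2 := hνm (t0 - 2 * √(v : ℝ) - z) t0 (by linarith)
        have l3 : L * (2 * √(v : ℝ) + z) ≤ L * (4 * √(v : ℝ)) :=
          mul_le_mul_of_nonneg_left (by linarith) hL0
        rw [show t0 - 2 * √(v : ℝ) - z + (2 * √(v : ℝ) + z) = t0 by ring] at l1
        simp only [hH, Pi.neg_apply] at h ⊢
        linarith
  refine (hD t).trans (le_of_forall_pos_le_add fun τ hτ => ?_)
  have := step (2 / 3 * τ) (by positivity)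
  linarith

/-- The law of the sum of `n` independent random variables with law `μ`. -/
def convPow (μ : Measure ℝ) : ℕ → Measure ℝ
  | 0 => Measure.dirac 0
  | n + 1 => convPow μ n ∗ μ

instance isProbabilityMeasure_convPow (μ : Measure ℝ) [IsProbabilityMeasure μ] (n : ℕ) :
    IsProbabilityMeasure (convPow μ n) := by
  induction n with
  | zero => exact inferInstanceAs (IsProbabilityMeasure (Measure.dirac (0 : ℝ)))
  | succ n ih => exact inferInstanceAs (IsProbabilityMeasure (convPow μ n ∗ μ))

lemma map_sum_pi (μ : Measure ℝ) [IsProbabilityMeasure μ] (n : ℕ) :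
    (Measure.pi fun _ : Fin n => μ).map (fun s => ∑ i, s i) = convPow μ n := by
  induction n with
  | zero =>
    rw [Measure.pi_of_empty]
    simp [convPow]
  | succ n ih =>
    have h := measurePreserving_piFinSuccAbove (fun _ : Fin (n + 1) => μ) 0
    have e : (fun s : Fin (n + 1) → ℝ => ∑ i, s i)
        = (fun p : ℝ × (Fin n → ℝ) => p.1 + ∑ i, p.2 i)
          ∘ (MeasurableEquiv.piFinSuccAbove (fun _ : Fin (n + 1) => ℝ) 0) := by
      ext s
      simp [Fin.sum_univ_succ, Fin.tail]
    rw [e, ← Measure.map_map (by fun_prop) (by fun_prop), h.map_eq, convPow, Measure.conv_comm,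
      ← ih, Measure.conv]
    rw [show (fun p : ℝ × (Fin n → ℝ) => p.1 + ∑ i, p.2 i)
      = (fun p : ℝ × ℝ => p.1 + p.2) ∘ (Prod.map id fun s : Fin n → ℝ => ∑ i, s i) from rfl,
      ← Measure.map_map (by fun_prop) (by fun_prop),
      ← Measure.map_prod_map _ _ (by fun_prop) (by fun_prop), Measure.map_id]

/-! ### The induction on the number of summands -/

/-- The distribution function of `N(0, v)` is Lipschitz with constant `v^(-1/2)`. -/
lemma gaussianReal_real_Iic_add_le {v : ℝ≥0} (hv : v ≠ 0) (t y : ℝ) (hy : 0 ≤ y) :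
    (gaussianReal 0 v).real (Set.Iic (t + y))
      ≤ (gaussianReal 0 v).real (Set.Iic t) + (√(v : ℝ))⁻¹ * y := by
  rw [gaussianReal_real_Iic hv, gaussianReal_real_Iic hv]
  have h := convex_univ.norm_image_sub_le_of_norm_hasDerivWithin_le (f := normalCDF)
    (f' := normalPDF) (C := 1) (fun z _ => (hasDerivAt_normalCDF z).hasDerivWithinAt)
    (fun z _ => by
      rw [Real.norm_eq_abs, abs_of_pos (normalPDF_pos z)]; exact normalPDF_le_one z)
    (Set.mem_univ (t / √(v : ℝ))) (Set.mem_univ ((t + y) / √(v : ℝ)))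
  rw [← sub_div, add_sub_cancel_left, one_mul, Real.norm_eq_abs, Real.norm_eq_abs,
    abs_of_nonneg (div_nonneg hy (Real.sqrt_nonneg _))] at h
  have := (abs_le.1 h).2
  rw [inv_mul_eq_div]
  linarith

lemma integrable_abs_pow_three_gaussianReal :
    Integrable (fun x => |x| ^ 3) (gaussianReal 0 1) :=
  (memLp_id_gaussianReal (μ := 0) (v := 1) 3).integrable_norm_pow (p := 3) (by norm_num)

lemma integral_sq_gaussianReal : ∫ x, x ^ 2 ∂(gaussianReal 0 1) = 1 := by
  have h := variance_fun_id_gaussianReal (μ := 0) (v := 1)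
  rw [variance_of_integral_eq_zero (by fun_prop) integral_id_gaussianReal] at h
  simpa using h

/-- Replacing one summand by a Gaussian in a sum of `m + 1` independent variables that is smoothed
by `N(0, v)`. The bound on the change improves with the quality `D` of the normal approximation of
the sum of the other `m` variables. -/
lemma abs_conv_swap_le (μ : Measure ℝ) [IsProbabilityMeasure μ]
    (h3 : Integrable (fun x => |x| ^ 3) μ) (h2 : Integrable (fun x => x ^ 2) μ)
    (h1 : Integrable (fun x => x) μ) (e1 : ∫ x, x ∂μ = 0) (e2 : ∫ x, x ^ 2 ∂μ = 1)
    (ν : Measure ℝ) [IsProbabilityMeasure ν] {v : ℝ≥0} (hv : v ≠ 0) (w : ℝ≥0) {D : ℝ}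
    (hD : ∀ t, |ν.real (Set.Iic t) - (gaussianReal 0 w).real (Set.Iic t)| ≤ D) (t : ℝ) :
    |((ν ∗ μ) ∗ gaussianReal 0 v).real (Set.Iic t)
        - (ν ∗ gaussianReal 0 (v + 1)).real (Set.Iic t)|
      ≤ (3 * (√((v + w : ℝ≥0) : ℝ))⁻¹ ^ 3 + D * (∫ u, |normalPDF3 u|) * (√(v : ℝ))⁻¹ ^ 3)
        * ((∫ x, |x| ^ 3 ∂μ) + ∫ x, |x| ^ 3 ∂(gaussianReal 0 1)) := by
  have a1 : (ν ∗ μ) ∗ gaussianReal 0 v = μ ∗ (ν ∗ gaussianReal 0 v) := by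
    rw [Measure.conv_comm ν μ, Measure.conv_assoc]
  have a2 : ν ∗ gaussianReal 0 (v + 1) = gaussianReal 0 1 ∗ (ν ∗ gaussianReal 0 v) := by
    rw [Measure.conv_comm (gaussianReal 0 1), Measure.conv_assoc, gaussianReal_conv_gaussianReal,
      add_zero]
  rw [a1, a2, conv_real_Iic, conv_real_Iic]
  obtain ⟨d1, d2, d3⟩ := exists_deriv_conv_gaussian ν hv
  have m1 : Integrable (fun x => x) (gaussianReal 0 1) :=
    memLp_one_iff_integrable.1 (memLp_id_gaussianReal 1)
  have m2 : Integrable (fun x => x ^ 2) (gaussianReal 0 1) :=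
    (memLp_id_gaussianReal (μ := 0) (v := 1) 2).integrable_sq
  have f1 : ∫ x, x ∂(gaussianReal 0 1) = 0 := integral_id_gaussianReal
  exact abs_integral_comp_sub_sub_le d1 d2 d3 (fun a => abs_third_deriv_conv_le ν hv w hD a)
    (C := 1) (fun a => by
      rw [abs_of_nonneg measureReal_nonneg]; exact measureReal_le_one)
    μ (gaussianReal 0 1) h1 h2 h3 m1 m2
    integrable_abs_pow_three_gaussianReal (by rw [e1, f1]) (by rw [e2, integral_sq_gaussianReal]) t

lemma inv_sqrt_pow_three_le {x : ℝ} (hx : 1 ≤ x) :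
    (√x)⁻¹ ^ 3 ≤ 4 * ((√x)⁻¹ - (√(x + 1))⁻¹) := by
  have ha : 1 ≤ √x := Real.one_le_sqrt.2 hx
  have ha2 : √x ^ 2 = x := Real.sq_sqrt (by linarith)
  have hb2 : √(x + 1) ^ 2 = x + 1 := Real.sq_sqrt (by linarith)
  have hb0 : 0 < √(x + 1) := Real.sqrt_pos.2 (by linarith)
  set a := √x
  set b := √(x + 1)
  have hb : b ≤ 3 / 2 * a := by nlinarith
  have e : a⁻¹ - b⁻¹ = 1 / (a * b * (a + b)) := by
    have : (b - a) * (a + b) = 1 := by nlinarith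
    field_simp
    linarith
  rw [e, inv_pow, ← one_div, ← mul_one_div, mul_one_div, mul_one_div,
    div_le_div_iff₀ (by positivity) (by positivity)]
  have : a * b * (a + b) ≤ a * (3 / 2 * a) * (a + 3 / 2 * a) := by gcongr
  nlinarith [pow_pos (show 0 < a by linarith) 3]

lemma sum_inv_sqrt_pow_three_le {x : ℝ} (hx : 1 ≤ x) (n : ℕ) :
    ∑ j ∈ Finset.range n, (√(x + j))⁻¹ ^ 3 ≤ 4 * (√x)⁻¹ := by
  have h : ∑ j ∈ Finset.range n, (√(x + j))⁻¹ ^ 3 ≤ 4 * ((√x)⁻¹ - (√(x + n))⁻¹) := by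
    induction n with
    | zero => simp
    | succ n ih =>
      rw [Finset.sum_range_succ]
      have := inv_sqrt_pow_three_le (x := x + n) (by
        have : (0 : ℝ) ≤ n := n.cast_nonneg
        linarith)
      push_cast
      rw [← add_assoc]
      linarith
  have : 0 ≤ (√(x + n))⁻¹ := by positivity
  linarith

/-- One step of the induction on the number of summands in the Berry-Esseen theorem: the bound
`K / √m` for all smaller numbers of summands enters the bound for `n` divided by `√v₀`. -/
lemma kolmogorov_convPow_le (μ : Measure ℝ) [IsProbabilityMeasure μ]
    (h3 : Integrable (fun x => |x| ^ 3) μ) (h2 : Integrable (fun x => x ^ 2) μ)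
    (h1 : Integrable (fun x => x) μ) (e1 : ∫ x, x ∂μ = 0) (e2 : ∫ x, x ^ 2 ∂μ = 1)
    {n : ℕ} (hn : 0 < n) {v₀ : ℝ≥0} (hv₀ : 1 ≤ v₀) {K : ℝ} (hK : 0 ≤ K)
    (ih : ∀ m, 0 < m → m < n → ∀ t,
      |(convPow μ m).real (Set.Iic t) - (gaussianReal 0 m).real (Set.Iic t)| ≤ K / √(m : ℝ))
    (t : ℝ) :
    |(convPow μ n).real (Set.Iic t) - (gaussianReal 0 n).real (Set.Iic t)|
      ≤ (2 * ((∫ x, |x| ^ 3 ∂μ) + ∫ x, |x| ^ 3 ∂(gaussianReal 0 1))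
          * (3 + 3 * (∫ u, |normalPDF3 u|) + 6 * (∫ u, |normalPDF3 u|) * K / √(v₀ : ℝ))
        + 6 * √(v₀ : ℝ)) / √(n : ℝ) := by
  set c := ∫ u, |normalPDF3 u| with hc
  set T := (∫ x, |x| ^ 3 ∂μ) + ∫ x, |x| ^ 3 ∂(gaussianReal 0 1) with hT
  have hc0 : 0 ≤ c := integral_nonneg fun u => abs_nonneg _
  have hT0 : 0 ≤ T := add_nonneg (integral_nonneg fun u => by positivity)
    (integral_nonneg fun u => by positivity)
  have hv0 : v₀ ≠ 0 := (lt_of_lt_of_le one_pos hv₀).ne'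
  have hn0 : ((n : ℝ≥0)) ≠ 0 := by exact_mod_cast hn.ne'
  have hnR : (1 : ℝ) ≤ n := by exact_mod_cast hn
  have hsn : 0 < √(n : ℝ) := Real.sqrt_pos.2 (by linarith)
  have hvR : (1 : ℝ) ≤ v₀ := by exact_mod_cast hv₀
  have hsv : 0 < √(v₀ : ℝ) := Real.sqrt_pos.2 (by linarith)
  -- the Kolmogorov distance for `m` summands: the trivial bound in the first half of the range
  set d : ℕ → ℝ := fun m => if 2 * m < n then 1 else 3 / 2 * K / √(n : ℝ) with hd
  have hdist : ∀ m, m < n → ∀ t,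
      |(convPow μ m).real (Set.Iic t) - (gaussianReal 0 m).real (Set.Iic t)| ≤ d m := by
    intro m hm t
    simp only [hd]
    split_ifs with hmn
    · have k1 : (convPow μ m).real (Set.Iic t) ≤ 1 := measureReal_le_one
      have k2 : (gaussianReal 0 (m : ℝ≥0)).real (Set.Iic t) ≤ 1 := measureReal_le_one
      have k3 : 0 ≤ (convPow μ m).real (Set.Iic t) := measureReal_nonneg
      have k4 : 0 ≤ (gaussianReal 0 (m : ℝ≥0)).real (Set.Iic t) := measureReal_nonneg
      rw [abs_le]; constructor <;> linarith
    · have hm0 : 0 < m := by omega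
      refine (ih m hm0 hm t).trans ?_
      have hmR : (0 : ℝ) < m := by exact_mod_cast hm0
      have hsm : 0 < √(m : ℝ) := Real.sqrt_pos.2 hmR
      have hle : √(n : ℝ) ≤ 3 / 2 * √(m : ℝ) := by
        rw [Real.sqrt_le_left (by positivity), mul_pow, Real.sq_sqrt hmR.le]
        have : (n : ℝ) ≤ 2 * m := by exact_mod_cast not_lt.1 hmn
        linarith
      rw [div_le_div_iff₀ hsm hsn]
      nlinarith
  have hstep : ∀ t, ∀ m ∈ Finset.range n,
      |(convPow μ (m + 1) ∗ gaussianReal 0 (v₀ + (n - (m + 1) : ℕ))).real (Set.Iic t)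
        - (convPow μ m ∗ gaussianReal 0 (v₀ + (n - m : ℕ))).real (Set.Iic t)|
      ≤ ((3 + 3 * c) * (√(n : ℝ))⁻¹ ^ 3
        + c * (3 / 2 * K / √(n : ℝ)) * (√((v₀ : ℝ) + (n - 1 - m : ℕ)))⁻¹ ^ 3) * T := by
    intro t m hm
    have hm' : m < n := Finset.mem_range.1 hm
    have hvm : v₀ + ((n - (m + 1) : ℕ) : ℝ≥0) ≠ 0 := by
      simp [hv0]
    have k := abs_conv_swap_le μ h3 h2 h1 e1 e2 (convPow μ m) hvm m (hdist m hm') t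
    have e : v₀ + ((n - (m + 1) : ℕ) : ℝ≥0) + 1 = v₀ + ((n - m : ℕ) : ℝ≥0) := by
      rw [add_assoc]; congr 1
      rw [show n - m = n - (m + 1) + 1 by omega]; push_cast; rfl
    rw [e] at k
    refine k.trans (mul_le_mul_of_nonneg_right ?_ hT0)
    have eN : n - 1 - m = n - (m + 1) := by omega
    rw [eN]
    simp only [NNReal.coe_add, NNReal.coe_natCast, ← hc]
    set s := √((v₀ : ℝ) + ((n - (m + 1) : ℕ) : ℝ)) with hs
    have hjn : ((n - (m + 1) : ℕ) : ℝ) + m + 1 = n := by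
      rw [← Nat.cast_add, ← Nat.cast_add_one]; congr 1; omega
    have hj0 : (0 : ℝ) ≤ ((n - (m + 1) : ℕ) : ℝ) := Nat.cast_nonneg _
    have hs0 : 0 < s := Real.sqrt_pos.2 (by linarith)
    have t1 : (√((v₀ : ℝ) + ((n - (m + 1) : ℕ) : ℝ) + m))⁻¹ ^ 3 ≤ (√(n : ℝ))⁻¹ ^ 3 := by
      gcongr; linarith
    have t2 : d m * s⁻¹ ^ 3
        ≤ 3 * (√(n : ℝ))⁻¹ ^ 3 + 3 / 2 * K / √(n : ℝ) * s⁻¹ ^ 3 := by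
      simp only [hd]
      split_ifs with hmn
      · have hle : √(n : ℝ) ≤ √2 * s := by
          rw [← Real.sqrt_mul (by norm_num)]
          refine Real.sqrt_le_sqrt ?_
          have : (2 * m + 1 : ℝ) ≤ n := by exact_mod_cast hmn
          linarith
        have hinv : s⁻¹ ≤ √2 * (√(n : ℝ))⁻¹ := by
          rw [inv_eq_one_div, ← div_eq_mul_inv, div_le_div_iff₀ hs0 hsn]; linarith
        have hp : s⁻¹ ^ 3 ≤ (√2 * (√(n : ℝ))⁻¹) ^ 3 := by gcongr
        have h23 : √2 ^ 3 ≤ 3 := by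
          have : √2 ^ 2 = 2 := Real.sq_sqrt (by norm_num)
          have h15 : √2 ≤ 3 / 2 := by rw [Real.sqrt_le_left (by norm_num)]; norm_num
          nlinarith
        have hp2 : (√2 * (√(n : ℝ))⁻¹) ^ 3 ≤ 3 * (√(n : ℝ))⁻¹ ^ 3 := by
          rw [mul_pow]; gcongr
        have : 0 ≤ 3 / 2 * K / √(n : ℝ) * s⁻¹ ^ 3 := by positivity
        linarith
      · have : 0 ≤ 3 * (√(n : ℝ))⁻¹ ^ 3 := by positivity
        linarith
    have t3 := mul_le_mul_of_nonneg_left t2 hc0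
    linarith
  -- only the smallest variances matter, as `∑ (v₀ + j)^(-3/2)` is of order `v₀^(-1/2)`
  have hsum : ∑ m ∈ Finset.range n, (√((v₀ : ℝ) + (n - 1 - m : ℕ)))⁻¹ ^ 3 ≤ 4 * (√(v₀ : ℝ))⁻¹ := by
    rw [Finset.sum_range_reflect (fun j => (√((v₀ : ℝ) + (j : ℕ)))⁻¹ ^ 3) n]
    exact sum_inv_sqrt_pow_three_le hvR n
  -- the swaps lead from `n` independent summands to `N(0, n)`, both smoothed by `N(0, v₀)`
  have hE : ∀ t, |(convPow μ n ∗ gaussianReal 0 v₀).real (Set.Iic t)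
      - (gaussianReal 0 n ∗ gaussianReal 0 v₀).real (Set.Iic t)|
      ≤ T * (3 + 3 * c + 6 * c * K / √(v₀ : ℝ)) / √(n : ℝ) := by
    intro t
    have tele := Finset.sum_range_sub (fun m =>
      (convPow μ m ∗ gaussianReal 0 (v₀ + (n - m : ℕ))).real (Set.Iic t)) n
    have e0 : convPow μ 0 ∗ gaussianReal 0 (v₀ + (n - 0 : ℕ))
        = gaussianReal 0 n ∗ gaussianReal 0 v₀ := by
      rw [convPow, Measure.dirac_zero_conv, gaussianReal_conv_gaussianReal, add_zero, add_comm]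
      rfl
    rw [e0, Nat.sub_self, Nat.cast_zero, add_zero] at tele
    rw [← tele]
    refine (Finset.abs_sum_le_sum_abs _ _).trans ((Finset.sum_le_sum (hstep t)).trans ?_)
    rw [← Finset.sum_mul, Finset.sum_add_distrib, Finset.sum_const, ← Finset.mul_sum,
      Finset.card_range, nsmul_eq_mul]
    have b1 : (n : ℝ) * ((3 + 3 * c) * (√(n : ℝ))⁻¹ ^ 3) = (3 + 3 * c) / √(n : ℝ) := by
      have : (n : ℝ) = √(n : ℝ) ^ 2 := (Real.sq_sqrt (by linarith)).symm
      rw [this, Real.sqrt_sq hsn.le]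
      field_simp
    have b2 : c * (3 / 2 * K / √(n : ℝ))
          * ∑ m ∈ Finset.range n, (√((v₀ : ℝ) + (n - 1 - m : ℕ)))⁻¹ ^ 3
        ≤ c * (3 / 2 * K / √(n : ℝ)) * (4 * (√(v₀ : ℝ))⁻¹) := by gcongr
    rw [b1]
    calc _ ≤ ((3 + 3 * c) / √(n : ℝ)
          + c * (3 / 2 * K / √(n : ℝ)) * (4 * (√(v₀ : ℝ))⁻¹)) * T := by gcongr
      _ = _ := by field_simp; ring
  refine (kolmogorov_le_of_smoothed _ _ hv0 (gaussianReal_real_Iic_add_le hn0) hE t).trans_eq ?_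
  simp only [NNReal.coe_natCast]
  field_simp

/-! ### The Berry-Esseen theorem -/

/-- Lyapunov's inequality for a unit second moment. -/
lemma one_le_integral_abs_pow_three (μ : Measure ℝ) [IsProbabilityMeasure μ]
    (h3 : Integrable (fun x => |x| ^ 3) μ) (h2 : Integrable (fun x => x ^ 2) μ)
    (e2 : ∫ x, x ^ 2 ∂μ = 1) : 1 ≤ ∫ x, |x| ^ 3 ∂μ := by
  have h := integral_mono (μ := μ) (h2.const_mul 3) ((h3.const_mul 2).add (integrable_const 1))
    fun x => by
      have : 3 * |x| ^ 2 ≤ 2 * |x| ^ 3 + 1 := by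
        nlinarith [mul_nonneg (abs_nonneg x) (sq_nonneg (|x| - 1)), sq_nonneg (|x| - 1),
          abs_nonneg x]
      simpa using this
  simp only [Pi.add_apply] at h
  rw [integral_add (h3.const_mul 2) (integrable_const 1), integral_const_mul, integral_const_mul,
    e2] at h
  simp at h
  linarith

/-- The Berry-Esseen theorem for standardized summands. -/
lemma exists_kolmogorov_convPow_le : ∃ K : ℝ, ∀ (μ : Measure ℝ), IsProbabilityMeasure μ →
    Integrable (fun x => |x| ^ 3) μ → Integrable (fun x => x ^ 2) μ → Integrable (fun x => x) μ →
    ∫ x, x ∂μ = 0 → ∫ x, x ^ 2 ∂μ = 1 → ∀ n : ℕ, 0 < n → ∀ t,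
      |(convPow μ n).real (Set.Iic t) - (gaussianReal 0 n).real (Set.Iic t)|
        ≤ K * (∫ x, |x| ^ 3 ∂μ) / √(n : ℝ) := by
  set c := ∫ u, |normalPDF3 u| with hc
  set g := ∫ x, |x| ^ 3 ∂(gaussianReal 0 1) with hg
  have hc0 : 0 ≤ c := integral_nonneg fun u => abs_nonneg _
  have hg0 : 0 ≤ g := integral_nonneg fun u => by positivity
  -- `A` makes the smoothing so strong that the induction hypothesis enters with a factor `1 / 2`
  set A := max 1 (24 * (1 + g) * c) with hA
  have hA1 : 1 ≤ A := le_max_left _ _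
  have hA2 : 24 * (1 + g) * c ≤ A := le_max_right _ _
  set K := 2 * (2 * (1 + g) * (3 + 3 * c) + 6 * A) with hK
  have hK0 : 0 ≤ K := by positivity
  refine ⟨K, fun μ _ h3 h2 h1 e1 e2 n => ?_⟩
  have hρ := one_le_integral_abs_pow_three μ h3 h2 e2
  induction n using Nat.strong_induction_on with
  | _ n ih =>
    intro hn t
    set ρ := ∫ x, |x| ^ 3 ∂μ with hρdef
    have hsn : 0 < √(n : ℝ) := Real.sqrt_pos.2 (by exact_mod_cast hn)
    have hAρ : 1 ≤ A * ρ := by nlinarith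
    have hv : 1 ≤ ((A * ρ) ^ 2).toNNReal := Real.one_le_toNNReal.2 (one_le_pow₀ hAρ)
    have k := kolmogorov_convPow_le μ h3 h2 h1 e1 e2 hn hv (K := K * ρ) (by positivity)
      (fun m hm hmn t => ih m hmn hm t) t
    refine k.trans ?_
    have es : √((((A * ρ) ^ 2).toNNReal : ℝ≥0) : ℝ) = A * ρ := by
      rw [Real.coe_toNNReal _ (sq_nonneg _), Real.sqrt_sq (by linarith)]
    rw [es]
    refine div_le_div_of_nonneg_right ?_ hsn.le
    have q1 : ρ + g ≤ (1 + g) * ρ := by nlinarith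
    have q2 : 6 * c * (K * ρ) / (A * ρ) = 6 * c * K / A := by
      field_simp
    have q3 : (1 + g) * (6 * c * K / A) ≤ K / 4 := by
      rw [← mul_div_assoc, div_le_iff₀ (by linarith)]
      nlinarith
    have q4 : 0 ≤ 6 * c * K / A := by positivity
    rw [q2]
    calc _ ≤ 2 * ((1 + g) * ρ) * (3 + 3 * c + 6 * c * K / A) + 6 * (A * ρ) := by gcongr
      _ = (2 * (1 + g) * (3 + 3 * c) + 2 * ((1 + g) * (6 * c * K / A)) + 6 * A) * ρ := by ring
      _ ≤ (2 * (1 + g) * (3 + 3 * c) + 2 * (K / 4) + 6 * A) * ρ := by gcongr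
      _ = K * ρ := by rw [hK]; ring

lemma gaussianQ_eq (t : ℝ) : gaussianQ t = (gaussianReal 0 1).real (Set.Ioi t) := by
  rw [gaussianReal_real_eq_integral, gaussianQ, ← integral_const_mul]
  rfl

lemma one_sub_gaussianQ (t : ℝ) : 1 - gaussianQ t = normalCDF t := by
  rw [gaussianQ_eq, normalCDF, ← Set.compl_Ioi, probReal_compl_eq_one_sub measurableSet_Ioi]

lemma memLp_three_of_integrable {μ : Measure ℝ} [IsProbabilityMeasure μ]
    (h : Integrable (fun x => |x| ^ 3) μ) : MemLp (fun x : ℝ => x) 3 μ :=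
  (integrable_norm_rpow_iff (p := 3) (by fun_prop) (by norm_num) (by norm_num)).1 (by simpa using h)

/-- The Berry-Esseen theorem: an admissible universal constant exists. -/
theorem exists_isBerryEsseenConstant : ∃ C, IsBerryEsseenConstant C := by
  obtain ⟨K, hK⟩ := exists_kolmogorov_convPow_le
  refine ⟨K, fun μ _ h3 hvar n hn t => ?_⟩
  have hL := memLp_three_of_integrable h3
  have hL2 : MemLp (fun x : ℝ => x) 2 μ := hL.mono_exponent (by norm_num)
  have hL1 : Integrable (fun x : ℝ => x) μ := hL.integrable (by norm_num)
  set m := ∫ x, x ∂μ with hm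
  set σ := √(variance (fun x : ℝ => x) μ) with hσ
  have hσ0 : 0 < σ := Real.sqrt_pos.2 hvar
  have hsn : 0 < √(n : ℝ) := Real.sqrt_pos.2 (by exact_mod_cast hn)
  set f : ℝ → ℝ := fun x => (x - m) / σ with hf
  have hfm : Measurable f := by fun_prop
  set ν := μ.map f with hν
  have hνp : IsProbabilityMeasure ν := Measure.isProbabilityMeasure_map hfm.aemeasurable
  have hc3 : Integrable (fun x => |x - m| ^ 3) μ :=
    (hL.sub (memLp_const m)).integrable_norm_pow (p := 3) (by norm_num)
  have hc2 : Integrable (fun x => (x - m) ^ 2) μ := (hL2.sub (memLp_const m)).integrable_sq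
  have habs : ∀ x, |f x| ^ 3 = |x - m| ^ 3 / σ ^ 3 := fun x => by
    simp only [hf]; rw [abs_div, div_pow, abs_of_pos hσ0]
  have hsq : ∀ x, f x ^ 2 = (x - m) ^ 2 / σ ^ 2 := fun x => by
    simp only [hf]; rw [div_pow]
  have n3 : Integrable (fun x => |x| ^ 3) ν := by
    rw [hν, integrable_map_measure (by fun_prop) hfm.aemeasurable]
    exact (hc3.div_const (σ ^ 3)).congr (Eventually.of_forall fun x => (habs x).symm)
  have n2 : Integrable (fun x => x ^ 2) ν := by
    rw [hν, integrable_map_measure (by fun_prop) hfm.aemeasurable]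
    exact (hc2.div_const (σ ^ 2)).congr (Eventually.of_forall fun x => (hsq x).symm)
  have n1 : Integrable (fun x => x) ν := by
    rw [hν, integrable_map_measure (by fun_prop) hfm.aemeasurable]
    exact (hL1.sub (integrable_const m)).div_const σ
  have e1 : ∫ x, x ∂ν = 0 := by
    rw [hν, integral_map hfm.aemeasurable (by fun_prop)]
    simp only [hf]
    rw [integral_div, integral_sub hL1 (integrable_const m)]
    simp [hm]
  have e2 : ∫ x, x ^ 2 ∂ν = 1 := by
    rw [hν, integral_map hfm.aemeasurable (by fun_prop)]
    simp_rw [hsq]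
    rw [integral_div, ← variance_eq_integral (by fun_prop), hσ, Real.sq_sqrt hvar.le,
      div_self hvar.ne']
  have e3 : ∫ x, |x| ^ 3 ∂ν = thirdAbsMoment (fun x : ℝ => x) μ / σ ^ 3 := by
    rw [hν, integral_map hfm.aemeasurable (by fun_prop)]
    simp_rw [habs]
    rw [integral_div]; rfl
  have h := hK ν hνp n3 n2 n1 e1 e2 n hn (t * √(n : ℝ))
  rw [e3, gaussianReal_real_Iic (by exact_mod_cast hn.ne')] at h
  simp only [NNReal.coe_natCast] at h
  rw [mul_div_cancel_right₀ _ hsn.ne', ← one_sub_gaussianQ] at h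
  have ev : (Measure.pi fun _ : Fin n => μ).real {s | ∑ i, (s i - m) ≤ t * (√(n : ℝ) * σ)}
      = (convPow ν n).real (Set.Iic (t * √(n : ℝ))) := by
    have hg : Measurable fun (s : Fin n → ℝ) i => f (s i) :=
      measurable_pi_lambda _ fun i => hfm.comp (measurable_pi_apply i)
    rw [← map_sum_pi, map_measureReal_apply (by fun_prop) measurableSet_Iic, hν,
      ← Measure.pi_map_pi (fun _ => hfm.aemeasurable),
      map_measureReal_apply hg (measurableSet_Iic.preimage (by fun_prop))]
    congr 1
    ext s
    simp only [hf, Set.mem_preimage, Set.mem_Iic, Set.mem_ofPred_eq]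
    rw [← Finset.sum_div, div_le_iff₀ hσ0, mul_assoc]
  rw [ev]
  refine h.trans_eq ?_
  field_simp

/-- Admissible constants are nonnegative, as the standard normal law itself shows. -/
lemma IsBerryEsseenConstant.nonneg {C : ℝ} (hC : IsBerryEsseenConstant C) : 0 ≤ C := by
  have h := hC (gaussianReal 0 1) inferInstance integrable_abs_pow_three_gaussianReal
    (by rw [variance_fun_id_gaussianReal]; simp) 1 one_pos 0
  have h1 := (abs_nonneg _).trans h
  have hM : 1 ≤ thirdAbsMoment (fun x : ℝ => x) (gaussianReal 0 1) := by
    have f1 : ∫ x, x ∂(gaussianReal 0 1) = 0 := integral_id_gaussianReal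
    unfold thirdAbsMoment
    rw [f1]
    simp only [sub_zero]
    exact one_le_integral_abs_pow_three _ integrable_abs_pow_three_gaussianReal
      (memLp_id_gaussianReal (μ := 0) (v := 1) 2).integrable_sq integral_sq_gaussianReal
  rw [variance_fun_id_gaussianReal] at h1
  simp at h1
  nlinarith

lemma berryEsseenC_nonneg : 0 ≤ berryEsseenC :=
  le_csInf exists_isBerryEsseenConstant fun _ hC => IsBerryEsseenConstant.nonneg hC

/-- The infimum that defines the universal constant is attained. -/
theorem isBerryEsseenConstant_berryEsseenC : IsBerryEsseenConstant berryEsseenC := by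
  intro μ hμ h3 hvar n hn t
  have hx : 0 ≤ thirdAbsMoment (fun x : ℝ => x) μ
      / (√(n : ℝ) * √(variance (fun x : ℝ => x) μ) ^ 3) :=
    div_nonneg (integral_nonneg fun _ => by positivity) (by positivity)
  obtain ⟨C₀, hC₀⟩ := exists_isBerryEsseenConstant
  rw [mul_div_assoc]
  rcases hx.eq_or_lt with h0 | h0
  · have := hC₀ μ hμ h3 hvar n hn t
    rw [mul_div_assoc, ← h0, mul_zero] at this
    rwa [← h0, mul_zero]
  · rw [← div_le_iff₀ h0]
    refine le_csInf ⟨C₀, hC₀⟩ fun C hC => ?_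
    rw [div_le_iff₀ h0, ← mul_div_assoc]
    exact hC μ hμ h3 hvar n hn t

/-! ### The Gaussian tail function and Laplace transforms of nearly normal laws -/

lemma hasDerivAt_gaussianQ (x : ℝ) : HasDerivAt gaussianQ (-normalPDF x) x := by
  have : gaussianQ = fun x => 1 - normalCDF x := by
    ext x; rw [← one_sub_gaussianQ]; ring
  rw [this]
  exact (hasDerivAt_normalCDF x).const_sub 1

lemma strictAnti_gaussianQ : StrictAnti gaussianQ :=
  strictAnti_of_deriv_neg fun x => by
    rw [(hasDerivAt_gaussianQ x).deriv]; linarith [normalPDF_pos x]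

lemma tendsto_normalCDF_atTop : Tendsto normalCDF atTop (nhds 1) := by
  refine (tendsto_cdf_atTop (gaussianReal 0 1)).congr fun x => ?_
  rw [cdf_eq_real, normalCDF]

lemma tendsto_normalCDF_atBot : Tendsto normalCDF atBot (nhds 0) := by
  refine (tendsto_cdf_atBot (gaussianReal 0 1)).congr fun x => ?_
  rw [cdf_eq_real, normalCDF]

lemma exists_gaussianQ_eq {p : ℝ} (h0 : 0 < p) (h1 : p < 1) : ∃ x, gaussianQ x = p := by
  obtain ⟨a, ha⟩ := (tendsto_normalCDF_atBot.eventually_lt_const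
    (show (0 : ℝ) < 1 - p by linarith)).exists
  obtain ⟨b, hb⟩ := (tendsto_normalCDF_atTop.eventually_const_lt
    (show 1 - p < 1 by linarith)).exists
  obtain ⟨x, hx⟩ := mem_range_of_exists_le_of_exists_ge continuous_normalCDF
    ⟨a, ha.le⟩ ⟨b, hb.le⟩
  refine ⟨x, ?_⟩
  have := one_sub_gaussianQ x
  linarith

lemma gaussianQ_gaussianQInv {p : ℝ} (h0 : 0 < p) (h1 : p < 1) : gaussianQ (gaussianQInv p) = p :=
  Function.invFun_eq (exists_gaussianQ_eq h0 h1)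

lemma gaussianQ_mem_Ioo (x : ℝ) : gaussianQ x ∈ Set.Ioo 0 1 := by
  have h1 := strictAnti_gaussianQ (show x < x + 1 by linarith)
  have h2 := strictAnti_gaussianQ (show x - 1 < x by linarith)
  have h3 : 0 ≤ gaussianQ (x + 1) := by rw [gaussianQ_eq]; exact measureReal_nonneg
  have h4 : gaussianQ (x - 1) ≤ 1 := by rw [gaussianQ_eq]; exact measureReal_le_one
  exact ⟨h3.trans_lt h1, h2.trans_le h4⟩

lemma gaussianQInv_gaussianQ (x : ℝ) : gaussianQInv (gaussianQ x) = x :=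
  Function.leftInverse_invFun strictAnti_gaussianQ.injective x

/-- The inverse of the Gaussian tail function is differentiable on `(0, 1)`. -/
lemma hasDerivAt_gaussianQInv {p : ℝ} (h0 : 0 < p) (h1 : p < 1) :
    HasDerivAt gaussianQInv (-normalPDF (gaussianQInv p))⁻¹ p := by
  have hanti : AntitoneOn gaussianQInv (Set.Ioo 0 1) := by
    intro a ha b hb hab
    by_contra! hlt
    have := strictAnti_gaussianQ hlt
    rw [gaussianQ_gaussianQInv ha.1 ha.2, gaussianQ_gaussianQInv hb.1 hb.2] at this
    linarith
  have hcont : ContinuousAt gaussianQInv p := by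
    have h : ContinuousAt (fun p => -gaussianQInv p) p := by
      refine continuousAt_of_monotoneOn_of_image_mem_nhds (s := Set.Ioo 0 1)
        (fun a ha b hb hab => neg_le_neg (hanti ha hb hab)) (Ioo_mem_nhds h0 h1) ?_
      convert univ_mem
      refine Set.eq_univ_of_forall fun y => ⟨gaussianQ (-y), gaussianQ_mem_Ioo _, ?_⟩
      simp only [gaussianQInv_gaussianQ, neg_neg]
    exact h.neg.congr (Eventually.of_forall fun q => neg_neg _)
  refine HasDerivAt.of_local_left_inverse hcont (hasDerivAt_gaussianQ _)
    (neg_ne_zero.2 (normalPDF_pos _).ne') ?_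
  filter_upwards [Ioo_mem_nhds h0 h1] with q hq
  exact gaussianQ_gaussianQInv hq.1 hq.2

/-- Laplace transform of the part of a law above `c`, by integration over the distribution
function. -/
lemma lintegral_exp_neg_Ioi (τ : Measure ℝ) [IsProbabilityMeasure τ] {a : ℝ} (ha : 0 < a) (c : ℝ) :
    ∫⁻ u in Set.Ioi c, ENNReal.ofReal (Real.exp (-(a * u))) ∂τ
      = ∫⁻ s in Set.Ioi c, ENNReal.ofReal (a * Real.exp (-(a * s))) * τ (Set.Ioc c s) := by
  have h1 : ∀ u, ENNReal.ofReal (Real.exp (-(a * u)))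
      = ∫⁻ s in Set.Ici u, ENNReal.ofReal (a * Real.exp (-(a * s))) := by
    intro u
    rw [setLIntegral_congr Ioi_ae_eq_Ici.symm, ← ofReal_integral_eq_lintegral_ofReal]
    · congr 1
      rw [integral_const_mul]
      have := integral_exp_mul_Ioi (neg_neg_of_pos ha) u
      simp only [neg_mul] at this
      rw [this]
      field_simp
    · have := (integrableOn_exp_mul_Ioi (neg_neg_of_pos ha) u).const_mul a
      simpa [neg_mul] using this
    · exact Eventually.of_forall fun s => by positivity
  have hm : MeasurableSet {p : ℝ × ℝ | c < p.1 ∧ p.1 ≤ p.2} :=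
    (measurableSet_lt measurable_const measurable_fst).inter
      (measurableSet_le measurable_fst measurable_snd)
  calc _ = ∫⁻ u, (∫⁻ s, Set.indicator {p : ℝ × ℝ | c < p.1 ∧ p.1 ≤ p.2}
        (fun p => ENNReal.ofReal (a * Real.exp (-(a * p.2)))) (u, s)) ∂τ := by
        rw [← lintegral_indicator measurableSet_Ioi]
        refine lintegral_congr fun u => ?_
        by_cases hu : c < u
        · rw [Set.indicator_of_mem (by exact hu), h1, ← lintegral_indicator measurableSet_Ici]
          refine lintegral_congr fun s => ?_
          simp [Set.indicator, hu]
        · rw [Set.indicator_of_notMem (by exact hu)]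
          simp [Set.indicator, hu]
    _ = ∫⁻ s, ∫⁻ u, Set.indicator {p : ℝ × ℝ | c < p.1 ∧ p.1 ≤ p.2}
        (fun p => ENNReal.ofReal (a * Real.exp (-(a * p.2)))) (u, s) ∂τ := by
        exact lintegral_lintegral_swap (Measurable.indicator
          (f := fun p : ℝ × ℝ => ENNReal.ofReal (a * Real.exp (-(a * p.2))))
            (by fun_prop) hm).aemeasurable
    _ = _ := by
        rw [← lintegral_indicator measurableSet_Ioi]
        refine lintegral_congr fun s => ?_
        have h2 : ∀ u, Set.indicator {p : ℝ × ℝ | c < p.1 ∧ p.1 ≤ p.2}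
            (fun p => ENNReal.ofReal (a * Real.exp (-(a * p.2)))) (u, s)
            = ENNReal.ofReal (a * Real.exp (-(a * s))) * (Set.Ioc c s).indicator 1 u := by
          intro u; simp [Set.indicator]
        simp_rw [h2]
        rw [lintegral_const_mul _ (measurable_one.indicator measurableSet_Ioc),
          lintegral_indicator_one measurableSet_Ioc]
        by_cases hs : c < s
        · rw [Set.indicator_of_mem (by exact hs)]
        · rw [Set.indicator_of_notMem (by exact hs), Set.Ioc_eq_empty hs]; simp

/-- Laplace transform of the part of the standard normal law above `c`. -/
lemma setIntegral_exp_neg_gaussianReal (a c : ℝ) :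
    ∫ u in Set.Ioi c, Real.exp (-(a * u)) ∂(gaussianReal 0 1)
      = Real.exp (a ^ 2 / 2) * gaussianQ (c + a) := by
  rw [← integral_indicator measurableSet_Ioi, integral_gaussianReal_eq_integral_smul one_ne_zero,
    gaussianQ, ← mul_assoc, ← integral_const_mul, ← integral_indicator measurableSet_Ioi]
  refine Eq.trans ?_ (integral_add_right_eq_self _ a)
  refine integral_congr_ae (Eventually.of_forall fun u => ?_)
  by_cases hu : c < u
  · simp only [gaussianPDFReal_zero_one, normalPDF, smul_eq_mul, Set.indicator, Set.mem_Ioi,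
      add_lt_add_iff_right, hu, if_true]
    rw [mul_assoc, mul_right_comm, ← Real.exp_add, ← Real.exp_add, mul_comm]
    ring_nf
  · simp [Set.indicator, hu]

/-- A law that is uniformly within `Δ` of the standard normal law has a Laplace transform over the
positive half line at least that of the normal law above the `1/2 - 2Δ` quantile. -/
lemma le_setIntegral_exp_neg (τ : Measure ℝ) [IsProbabilityMeasure τ] {Δ a : ℝ} (ha : 0 ≤ a)
    (hτ : ∀ t, |τ.real (Set.Iic t) - (1 - gaussianQ t)| ≤ Δ) (hΔ : 2 * Δ < 1 / 2) :
    Real.exp (a ^ 2 / 2) * gaussianQ (gaussianQInv (1 / 2 - 2 * Δ) + a)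
      ≤ ∫ u in Set.Ioi 0, Real.exp (-(a * u)) ∂τ := by
  have hΔ0 : 0 ≤ Δ := (abs_nonneg _).trans (hτ 0)
  set ρ := gaussianQInv (1 / 2 - 2 * Δ) with hρ
  have hQρ : gaussianQ ρ = 1 / 2 - 2 * Δ := gaussianQ_gaussianQInv (by linarith) (by linarith)
  have hQ0 : gaussianQ 0 = 1 / 2 := by
    have h1 : gaussianQ 0 = (gaussianReal 0 1).real (Set.Iio 0) := by
      have h2 : (gaussianReal 0 1).map (fun x => -x) = gaussianReal 0 1 := by
        rw [gaussianReal_map_neg, neg_zero]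
      rw [gaussianQ_eq]
      conv_lhs => rw [← h2]
      rw [map_measureReal_apply (by fun_prop) measurableSet_Ioi]
      congr 1; ext; simp
    have h2 : (gaussianReal 0 1).real (Set.Iio 0) = (gaussianReal 0 1).real (Set.Iic 0) := by
      have := nullSingletonClass_gaussianReal (μ := 0) (v := 1) one_ne_zero
      exact measureReal_congr Iio_ae_eq_Iic
    have h3 := one_sub_gaussianQ 0
    rw [normalCDF] at h3
    linarith
  have hρ0 : 0 ≤ ρ := by
    by_contra! h
    have := strictAnti_gaussianQ h
    linarith
  have hint : ∀ (κ : Measure ℝ), IsProbabilityMeasure κ → ∀ c, 0 ≤ c →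
      IntegrableOn (fun u => Real.exp (-(a * u))) (Set.Ioi c) κ := by
    intro κ _ c hc
    refine Integrable.of_bound (C := 1) (by fun_prop) ?_
    filter_upwards [ae_restrict_mem measurableSet_Ioi] with u hu
    rw [Real.norm_eq_abs, abs_of_pos (Real.exp_pos _), Real.exp_le_one_iff]
    have : c < u := hu
    nlinarith
  rcases ha.eq_or_lt with rfl | ha
  · have := (abs_le.1 (hτ 0)).2
    rw [hQ0] at this
    have e := probReal_compl_eq_one_sub (μ := τ) (measurableSet_Iic (a := (0 : ℝ)))
    rw [Set.compl_Iic] at e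
    simp [hQρ]
    linarith
  rw [← setIntegral_exp_neg_gaussianReal]
  -- compare `(ρ, s]` with `(0, s]`: by the choice of `ρ`, the normal mass of `(0, ρ]` is `2Δ`
  have key : ∀ s, ρ < s → (gaussianReal 0 1) (Set.Ioc ρ s) ≤ τ (Set.Ioc 0 s) := by
    intro s hs
    rw [← ENNReal.toReal_le_toReal (measure_ne_top _ _) (measure_ne_top _ _)]
    change (gaussianReal 0 1).real _ ≤ τ.real _
    have l : ∀ (κ : Measure ℝ), IsProbabilityMeasure κ → ∀ c, c ≤ s →
        κ.real (Set.Ioc c s) = κ.real (Set.Iic s) - κ.real (Set.Iic c) := by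
      intro κ _ c hc
      have e : Set.Ioc c s = Set.Iic s \ Set.Iic c := by ext; simp [and_comm]
      rw [e, measureReal_sdiff (Set.Iic_subset_Iic.2 hc) measurableSet_Iic]
    rw [l _ inferInstance ρ hs.le, l _ inferInstance 0 (hρ0.trans hs.le)]
    change normalCDF s - normalCDF ρ ≤ _
    rw [← one_sub_gaussianQ, ← one_sub_gaussianQ, hQρ]
    have k1 := (abs_le.1 (hτ s)).1
    have k2 := (abs_le.1 (hτ 0)).2
    rw [hQ0] at k2
    linarith
  have hl : ∫⁻ u in Set.Ioi ρ, ENNReal.ofReal (Real.exp (-(a * u))) ∂(gaussianReal 0 1)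
      ≤ ∫⁻ u in Set.Ioi 0, ENNReal.ofReal (Real.exp (-(a * u))) ∂τ := by
    rw [lintegral_exp_neg_Ioi _ ha, lintegral_exp_neg_Ioi _ ha]
    calc _ ≤ ∫⁻ s in Set.Ioi ρ, ENNReal.ofReal (a * Real.exp (-(a * s))) * τ (Set.Ioc 0 s) := by
          refine setLIntegral_mono' measurableSet_Ioi fun s hs => ?_
          exact mul_le_mul_right (key s hs) _
      _ ≤ _ := lintegral_mono_set (Set.Ioi_subset_Ioi hρ0)
  rw [← ofReal_integral_eq_lintegral_ofReal (hint _ inferInstance ρ hρ0)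
      (Eventually.of_forall fun _ => (Real.exp_pos _).le),
    ← ofReal_integral_eq_lintegral_ofReal (hint τ inferInstance 0 le_rfl)
      (Eventually.of_forall fun _ => (Real.exp_pos _).le)] at hl
  exact (ENNReal.ofReal_le_ofReal_iff (integral_nonneg fun _ => (Real.exp_pos _).le)).1 hl

/-! ### Tails of sums of independent variables -/

lemma lintegral_pi_prod {ι : Type*} [Fintype ι] {α : ι → Type*} [∀ i, MeasurableSpace (α i)]
    (μ : ∀ i, Measure (α i)) [∀ i, IsProbabilityMeasure (μ i)] {f : ∀ i, α i → ℝ≥0∞}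
    (hf : ∀ i, Measurable (f i)) :
    ∫⁻ x, ∏ i, f i (x i) ∂(Measure.pi μ) = ∏ i, ∫⁻ x, f i x ∂(μ i) := by
  have h := iIndepFun_pi (μ := μ) (X := f) fun i => (hf i).aemeasurable
  rw [lintegral_prod_eq_prod_lintegral_of_indepFun Finset.univ _ h
    (fun i => (hf i).comp (measurable_pi_apply i))]
  refine Finset.prod_congr rfl fun i _ => ?_
  have e := (measurePreserving_eval μ i).lintegral_comp (hf i)
  exact e

/-- A product of measures with densities has the product density. -/
lemma pi_withDensity {ι : Type*} [Fintype ι] {α : ι → Type*} [∀ i, MeasurableSpace (α i)]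
    (μ : ∀ i, Measure (α i)) [∀ i, IsProbabilityMeasure (μ i)] {f : ∀ i, α i → ℝ≥0∞}
    (hf : ∀ i, Measurable (f i)) [∀ i, SigmaFinite ((μ i).withDensity (f i))] :
    Measure.pi (fun i => (μ i).withDensity (f i))
      = (Measure.pi μ).withDensity fun x => ∏ i, f i (x i) := by
  refine Measure.pi_eq fun s hs => ?_
  rw [withDensity_apply _ (MeasurableSet.univ_pi hs), ← lintegral_indicator (MeasurableSet.univ_pi hs)]
  have e : (fun x => (Set.univ.pi s).indicator (fun x => ∏ i, f i (x i)) x)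
      = fun x => ∏ i, (s i).indicator (f i) (x i) := by
    ext x
    by_cases hx : x ∈ Set.univ.pi s
    · rw [Set.indicator_of_mem hx]
      exact Finset.prod_congr rfl fun i _ =>
        (Set.indicator_of_mem (hx i (Set.mem_univ i)) _).symm
    · rw [Set.indicator_of_notMem hx]
      simp only [Set.mem_pi, Set.mem_univ, true_implies, not_forall] at hx
      obtain ⟨i, hi⟩ := hx
      exact (Finset.prod_eq_zero (Finset.mem_univ i) (Set.indicator_of_notMem hi _)).symm
  rw [e, lintegral_pi_prod μ fun i => (hf i).indicator (hs i)]
  refine Finset.prod_congr rfl fun i _ => ?_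
  rw [lintegral_indicator (hs i), withDensity_apply _ (hs i)]

/-- Exponential tilting is undone by the inverse density. -/
lemma tilted_withDensity_inv (ν : Measure ℝ) [IsProbabilityMeasure ν] {l : ℝ}
    (hl : Integrable (fun x => Real.exp (l * x)) ν) :
    (ν.tilted fun x => l * x).withDensity
      (fun x => ENNReal.ofReal (Real.exp (cgf (fun x => x) ν l - l * x))) = ν := by
  have hpos : 0 < ∫ x, Real.exp (l * x) ∂ν := integral_exp_pos hl
  rw [Measure.tilted, ← withDensity_mul _ (by fun_prop) (by fun_prop)]
  conv_rhs => rw [← withDensity_one (μ := ν)]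
  congr 1
  ext x
  rw [Pi.mul_apply, ← ENNReal.ofReal_mul (by positivity), cgf, mgf, Real.exp_sub,
    Real.exp_log hpos, Pi.one_apply, ← ENNReal.ofReal_one]
  congr 1
  have := Real.exp_pos (l * x)
  field_simp

lemma pi_eq_pi_tilted_withDensity (ν : Measure ℝ) [IsProbabilityMeasure ν] {l : ℝ}
    (hl : Integrable (fun x => Real.exp (l * x)) ν) (n : ℕ) :
    (Measure.pi fun _ : Fin n => ν) = (Measure.pi fun _ : Fin n => ν.tilted fun x => l * x).withDensity
      fun s => ENNReal.ofReal (Real.exp (n * cgf (fun x => x) ν l - l * ∑ i, s i)) := by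
  have := isProbabilityMeasure_tilted hl
  have hinv := tilted_withDensity_inv ν hl
  have hs : SigmaFinite ((ν.tilted fun x => l * x).withDensity
      (fun x => ENNReal.ofReal (Real.exp (cgf (fun x => x) ν l - l * x)))) := by
    rw [hinv]; infer_instance
  have h := pi_withDensity (fun _ : Fin n => ν.tilted fun x => l * x)
    (f := fun _ x => ENNReal.ofReal (Real.exp (cgf (fun x => x) ν l - l * x)))
    (fun _ => by fun_prop)
  simp only [hinv] at h
  rw [h]
  congr 1
  ext s
  rw [← ENNReal.ofReal_prod_of_nonneg fun i _ => (Real.exp_pos _).le, ← Real.exp_sum,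
    Finset.sum_sub_distrib, Finset.mul_sum]
  simp

/-- The Berry-Esseen theorem for the normalized sum, as a law on the line. -/
lemma abs_map_normalized_sum_sub_le (κ : Measure ℝ) [IsProbabilityMeasure κ]
    (h3 : Integrable (fun x => |x| ^ 3) κ) (hvar : 0 < variance (fun x : ℝ => x) κ)
    {n : ℕ} (hn : 0 < n) (t : ℝ) :
    |((Measure.pi fun _ : Fin n => κ).map fun s => (∑ i, (s i - ∫ x, x ∂κ))
          / (√(n : ℝ) * √(variance (fun x : ℝ => x) κ))).real (Set.Iic t) - (1 - gaussianQ t)|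
      ≤ berryEsseenC * thirdAbsMoment (fun x : ℝ => x) κ
          / (√(n : ℝ) * √(variance (fun x : ℝ => x) κ) ^ 3) := by
  have h := isBerryEsseenConstant_berryEsseenC κ inferInstance h3 hvar n hn t
  have hpos : 0 < √(n : ℝ) * √(variance (fun x : ℝ => x) κ) :=
    mul_pos (Real.sqrt_pos.2 (by exact_mod_cast hn)) (Real.sqrt_pos.2 hvar)
  rw [map_measureReal_apply (by fun_prop) measurableSet_Iic]
  convert h using 4
  ext s
  simp [div_le_iff₀ hpos]

/-- The normal approximation of an upper tail. -/
lemma gaussianQ_sub_le_tail (κ : Measure ℝ) [IsProbabilityMeasure κ]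
    (h3 : Integrable (fun x => |x| ^ 3) κ) (hvar : 0 < variance (fun x : ℝ => x) κ)
    {n : ℕ} (hn : 0 < n) (t : ℝ) :
    gaussianQ t - berryEsseenC * thirdAbsMoment (fun x : ℝ => x) κ
          / (√(n : ℝ) * √(variance (fun x : ℝ => x) κ) ^ 3)
      ≤ (Measure.pi fun _ : Fin n => κ).real
        {s | n * (∫ x, x ∂κ) + t * (√(n : ℝ) * √(variance (fun x : ℝ => x) κ)) < ∑ i, s i} := by
  have h := isBerryEsseenConstant_berryEsseenC κ inferInstance h3 hvar n hn t
  have hm : MeasurableSet {s : Fin n → ℝ | ∑ i, (s i - ∫ x, x ∂κ)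
      ≤ t * (√(n : ℝ) * √(variance (fun x : ℝ => x) κ))} :=
    measurableSet_le (by fun_prop) measurable_const
  have hc := probReal_compl_eq_one_sub (μ := Measure.pi fun _ : Fin n => κ) hm
  have e : {s : Fin n → ℝ | ∑ i, (s i - ∫ x, x ∂κ)
      ≤ t * (√(n : ℝ) * √(variance (fun x : ℝ => x) κ))}ᶜ
      = {s | n * (∫ x, x ∂κ) + t * (√(n : ℝ) * √(variance (fun x : ℝ => x) κ)) < ∑ i, s i} := by
    ext s
    simp only [Finset.sum_sub_distrib, Finset.sum_const, Finset.card_univ, Fintype.card_fin,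
      nsmul_eq_mul, Set.mem_compl_iff, Set.mem_ofPred_eq, not_le]
    constructor <;> intro h <;> linarith
  rw [e] at hc
  have := (abs_le.1 h).2
  linarith

/-- Sharp exponential lower bound for the probability that a sum exceeds the mean of the tilted
sum: change of measure to the tilted law, for which the event is a central one. -/
lemma exponential_tail_lower_bound (ν : Measure ℝ) [IsProbabilityMeasure ν] {l : ℝ} (hl0 : 0 ≤ l)
    (hl : Integrable (fun x => Real.exp (l * x)) ν) {κ : Measure ℝ}
    (hκ : κ = ν.tilted fun x => l * x)
    (h3 : Integrable (fun x => |x| ^ 3) κ) {σ Δ : ℝ}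
    (hσ : σ = √(variance (fun x : ℝ => x) κ)) (hσ0 : 0 < σ) {n : ℕ} (hn : 0 < n)
    (hΔ : Δ = berryEsseenC * thirdAbsMoment (fun x : ℝ => x) κ / (√(n : ℝ) * σ ^ 3))
    (hΔ1 : 2 * Δ < 1 / 2) :
    Real.exp (n * l ^ 2 * σ ^ 2 / 2) * gaussianQ (gaussianQInv (1 / 2 - 2 * Δ) + √(n : ℝ) * l * σ)
        * Real.exp (-(n * (l * (∫ x, x ∂κ) - cgf (fun x => x) ν l)))
      ≤ (Measure.pi fun _ : Fin n => ν).real {s | n * (∫ x, x ∂κ) < ∑ i, s i} := by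
  have hκp : IsProbabilityMeasure κ := by rw [hκ]; exact isProbabilityMeasure_tilted hl
  have hvar : 0 < variance (fun x : ℝ => x) κ := Real.sqrt_pos.1 (hσ ▸ hσ0)
  have hsn : 0 < √(n : ℝ) := Real.sqrt_pos.2 (by exact_mod_cast hn)
  have hBE := abs_map_normalized_sum_sub_le κ h3 hvar hn
  simp only [← hσ, ← hΔ] at hBE
  set m := ∫ x, x ∂κ with hm
  set Λ := cgf (fun x => x) ν l with hΛ
  set P := Measure.pi fun _ : Fin n => κ with hP
  set U : (Fin n → ℝ) → ℝ := fun s => (∑ i, (s i - m)) / (√(n : ℝ) * σ) with hU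
  have hUm : Measurable U := by fun_prop
  have hτ : IsProbabilityMeasure (P.map U) := Measure.isProbabilityMeasure_map hUm.aemeasurable
  have key := le_setIntegral_exp_neg (P.map U) (a := √(n : ℝ) * l * σ) (by positivity) hBE hΔ1
  have hA : MeasurableSet {s : Fin n → ℝ | n * m < ∑ i, s i} :=
    measurableSet_lt measurable_const (by fun_prop)
  have hpre : U ⁻¹' Set.Ioi 0 = {s : Fin n → ℝ | n * m < ∑ i, s i} := by
    ext s
    simp only [hU, Set.mem_preimage, Set.mem_Ioi, Set.mem_ofPred_eq, Finset.sum_sub_distrib,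
      Finset.sum_const, Finset.card_univ, Fintype.card_fin, nsmul_eq_mul]
    rw [div_pos_iff_of_pos_right (by positivity), sub_pos]
  rw [setIntegral_map measurableSet_Ioi (by fun_prop) hUm.aemeasurable, hpre] at key
  have e1 : (Measure.pi fun _ : Fin n => ν).real {s | n * m < ∑ i, s i}
      = ∫ s in {s | n * m < ∑ i, s i}, Real.exp (n * Λ - l * ∑ i, s i) ∂P := by
    rw [pi_eq_pi_tilted_withDensity ν hl n, Measure.real, withDensity_apply _ hA, ← hκ,
      integral_eq_lintegral_of_nonneg_ae (Eventually.of_forall fun _ => (Real.exp_pos _).le)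
        (by fun_prop)]
  have e2 : ∀ s : Fin n → ℝ, Real.exp (n * Λ - l * ∑ i, s i)
      = Real.exp (-(n * (l * m - Λ))) * Real.exp (-(√(n : ℝ) * l * σ * U s)) := by
    intro s
    rw [← Real.exp_add]
    congr 1
    have : √(n : ℝ) * l * σ * U s = l * (∑ i, s i - n * m) := by
      simp only [hU, Finset.sum_sub_distrib, Finset.sum_const, Finset.card_univ, Fintype.card_fin,
        nsmul_eq_mul]
      field_simp
    rw [this]; ring
  rw [e1]
  simp_rw [e2]
  rw [integral_const_mul, mul_comm]
  refine mul_le_mul_of_nonneg_left ?_ (Real.exp_pos _).le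
  refine le_trans (le_of_eq ?_) key
  congr 2
  rw [mul_pow, mul_pow, Real.sq_sqrt n.cast_nonneg]

/-! ### The law of the conditional information and the capacity -/

namespace BinaryChannel

variable {𝒴 : Type*} [MeasurableSpace 𝒴] (W : BinaryChannel 𝒴)

lemma posterior_nonneg (x : Bool) (y : 𝒴) : 0 ≤ W.posterior x y := by
  unfold posterior; positivity

lemma density_le_sum (x : Bool) (y : 𝒴) :
    (W.density x y : ℝ) ≤ ∑ u : Bool, (W.density u y : ℝ) :=
  Finset.single_le_sum (f := fun u => (W.density u y : ℝ)) (fun _ _ => NNReal.coe_nonneg _)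
    (Finset.mem_univ x)

lemma posterior_le_one (x : Bool) (y : 𝒴) : W.posterior x y ≤ 1 :=
  div_le_one_of_le₀ (W.density_le_sum x y) (Finset.sum_nonneg fun _ _ => NNReal.coe_nonneg _)

lemma measurable_posterior (x : Bool) : Measurable (W.posterior x) := by
  have := W.measurable_density
  unfold posterior
  fun_prop

lemma info_nonneg (ω : Bool × 𝒴) : 0 ≤ W.info ω :=
  neg_nonneg.2 (Real.log_nonpos (W.posterior_nonneg _ _) (W.posterior_le_one _ _))

lemma measurable_info_mk (x : Bool) : Measurable fun y => W.info (x, y) :=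
  (Real.measurable_log.comp (W.measurable_posterior x)).neg

lemma measurable_info : Measurable W.info :=
  measurable_from_prod_countable_right fun x => W.measurable_info_mk x

instance isProbabilityMeasure_law (x : Bool) : IsProbabilityMeasure (W.law x) :=
  ⟨by rw [law, withDensity_apply _ MeasurableSet.univ, Measure.restrict_univ,
    W.lintegral_density]⟩

lemma outputLaw_eq : W.outputLaw = ∑ x : Bool, (2⁻¹ : ℝ≥0∞) • W.law x := by
  have h := fun x => (W.measurable_density x).coe_nnreal_ennreal
  have e : (fun y => 2⁻¹ * ∑ x : Bool, (W.density x y : ℝ≥0∞))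
      = (2⁻¹ : ℝ≥0∞) • ((fun y => (W.density true y : ℝ≥0∞)) + fun y => (W.density false y : ℝ≥0∞)) := by
    ext y; simp
  rw [outputLaw, e, withDensity_smul _ ((h _).add (h _)), withDensity_add_left (h _)]
  simp [law]

instance isProbabilityMeasure_outputLaw : IsProbabilityMeasure W.outputLaw :=
  ⟨by rw [outputLaw_eq]; simp [ENNReal.inv_two_add_inv_two]⟩

instance isProbabilityMeasure_joint : IsProbabilityMeasure W.joint :=
  ⟨by simp [joint, Measure.map_apply measurable_prodMk_left, ENNReal.inv_two_add_inv_two]⟩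

/-- The law of the output in response to `x` has density `2 p(x|y)` with respect to the law of
`Y`. -/
lemma law_eq_withDensity (x : Bool) :
    W.law x = W.outputLaw.withDensity fun y => ENNReal.ofReal (2 * W.posterior x y) := by
  have h := fun x => (W.measurable_density x).coe_nnreal_ennreal
  have hp := W.measurable_posterior x
  rw [outputLaw, ← withDensity_mul _ (by fun_prop) (by fun_prop), law]
  congr 1
  ext y
  have e : (2⁻¹ * ∑ u : Bool, (W.density u y : ℝ≥0∞))
      = ENNReal.ofReal (2⁻¹ * ∑ u : Bool, (W.density u y : ℝ)) := by
    rw [ENNReal.ofReal_mul (by norm_num), ENNReal.ofReal_sum_of_nonneg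
      (fun _ _ => NNReal.coe_nonneg _)]
    simp [ENNReal.ofReal_inv_of_pos]
  rw [Pi.mul_apply, e, ← ENNReal.ofReal_mul (by positivity), ← ENNReal.ofReal_coe_nnreal]
  congr 1
  unfold posterior
  rcases eq_or_ne (∑ u : Bool, (W.density u y : ℝ)) 0 with h0 | h0
  · have := W.density_le_sum x y
    rw [h0] at this ⊢
    simp [le_antisymm this (NNReal.coe_nonneg _)]
  · field_simp

lemma ae_posterior_pos (x : Bool) : ∀ᵐ y ∂(W.law x), 0 < W.posterior x y := by
  have hp := W.measurable_posterior x
  rw [law_eq_withDensity, ae_withDensity_iff (by fun_prop)]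
  refine Eventually.of_forall fun y hy => ?_
  simpa using hy

lemma map_info_joint :
    W.joint.map W.info = ∑ x : Bool, (2⁻¹ : ℝ≥0∞) • (W.law x).map fun y => W.info (x, y) := by
  have hm := W.measurable_info
  rw [joint, Measure.map_finset_sum hm.aemeasurable]
  refine Finset.sum_congr rfl fun x _ => ?_
  rw [Measure.map_smul, Measure.map_map hm measurable_prodMk_left]
  rfl

/-- The law of the conditional information `-ln p(X|Y)`. -/
def infoLaw : Measure ℝ := W.joint.map W.info

instance isProbabilityMeasure_infoLaw : IsProbabilityMeasure W.infoLaw :=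
  Measure.isProbabilityMeasure_map W.measurable_info.aemeasurable

variable {W} in
/-- For a symmetric channel the conditional information has the same law given each input. -/
lemma IsSymmetric.map_law_info (h : W.IsSymmetric) (x : Bool) :
    (W.law x).map (fun y => W.info (x, y)) = W.infoLaw := by
  rw [infoLaw, map_info_joint, Fintype.sum_bool, ← h, ← add_smul,
    ENNReal.inv_two_add_inv_two, one_smul]
  cases x
  · rfl
  · exact h.symm

lemma ae_joint_posterior_pos : ∀ᵐ ω ∂W.joint, 0 < W.posterior ω.1 ω.2 := by
  have hm : MeasurableSet {ω : Bool × 𝒴 | 0 < W.posterior ω.1 ω.2} :=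
    measurableSet_lt measurable_const
      (measurable_from_prod_countable_right fun x => W.measurable_posterior x)
  rw [joint, ae_iff]
  simp only [Measure.coe_finsetSum, Finset.sum_apply, Measure.smul_apply]
  refine Finset.sum_eq_zero fun x _ => ?_
  have h := W.ae_posterior_pos x
  rw [ae_iff] at h
  have e : (W.law x).map (Prod.mk x) {ω | ¬0 < W.posterior ω.1 ω.2} = 0 := by
    refine (Measure.map_apply measurable_prodMk_left hm.compl).trans h
  rw [e, smul_zero]

/-- `E[1 / p(X|Y)]` is finite, as `2 p(x|y)` is the density of `Y` given `x` with respect to the law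
of `Y`. -/
lemma integrable_exp_info : Integrable (fun ω => Real.exp (1 * W.info ω)) W.joint := by
  have hm := W.measurable_info
  refine ⟨by fun_prop, ?_⟩
  rw [hasFiniteIntegral_iff_ofReal (Eventually.of_forall fun _ => (Real.exp_pos _).le), joint,
    lintegral_finsetSum_measure]
  refine ENNReal.sum_lt_top.2 fun x _ => ?_
  have hmx := W.measurable_info_mk x
  have hp := W.measurable_posterior x
  rw [lintegral_smul_measure, lintegral_map (by fun_prop) measurable_prodMk_left,
    law_eq_withDensity, lintegral_withDensity_eq_lintegral_mul _ (by fun_prop) (by fun_prop)]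
  refine ENNReal.mul_lt_top (by simp) (lt_of_le_of_lt (lintegral_mono (g := fun _ => 2) fun y => ?_)
    (by simp))
  rw [Pi.mul_apply, ← ENNReal.ofReal_mul (mul_nonneg zero_le_two (W.posterior_nonneg _ _)),
    ← ENNReal.ofReal_ofNat 2]
  refine ENNReal.ofReal_le_ofReal ?_
  rcases (W.posterior_nonneg x y).eq_or_lt with h0 | h0
  · simp [← h0]
  · rw [info, one_mul, Real.exp_neg, Real.exp_log h0, mul_assoc, mul_inv_cancel₀ h0.ne', mul_one]

lemma Iic_one_subset_integrableExpSet : Set.Iic 1 ⊆ integrableExpSet W.info W.joint := by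
  intro l hl
  have hm := W.measurable_info
  refine W.integrable_exp_info.mono' (by fun_prop) (Eventually.of_forall fun ω => ?_)
  rw [Real.norm_eq_abs, abs_of_pos (Real.exp_pos _)]
  exact Real.exp_le_exp.2 (mul_le_mul_of_nonneg_right hl (W.info_nonneg ω))

/-- Below `λ*` all exponential moments exist nearby: `-ln p(X|Y)` is nonnegative, so that negative
exponents do no harm. -/
lemma mem_interior_integrableExpSet {l : ℝ} (hl : (l : EReal) < W.lambdaStar) :
    l ∈ interior (integrableExpSet W.info W.joint) := by
  obtain ⟨_, ⟨L, hL, rfl⟩, hlt⟩ := lt_sSup_iff.1 hl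
  have hlL : l < L := EReal.coe_lt_coe_iff.1 hlt
  refine mem_interior.2 ⟨Set.Iio L, fun k hk => ?_, isOpen_Iio, hlL⟩
  have hm := W.measurable_info
  refine Integrable.mono' (g := fun ω => Real.exp (L * W.info ω)) hL.2 (by fun_prop)
    (Eventually.of_forall fun ω => ?_)
  rw [Real.norm_eq_abs, abs_of_pos (Real.exp_pos _)]
  exact Real.exp_le_exp.2 (mul_le_mul_of_nonneg_right (le_of_lt hk) (W.info_nonneg ω))

lemma zero_mem_interior_integrableExpSet :
    (0 : ℝ) ∈ interior (integrableExpSet W.info W.joint) :=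
  mem_interior.2 ⟨Set.Iio 1, fun _ hk => W.Iic_one_subset_integrableExpSet (Set.Iio_subset_Iic_self hk),
    isOpen_Iio, zero_lt_one (α := ℝ)⟩

lemma integrable_info : Integrable W.info W.joint :=
  integrable_of_mem_interior_integrableExpSet W.zero_mem_interior_integrableExpSet

lemma integrable_info_mk (x : Bool) : Integrable (fun y => W.info (x, y)) (W.law x) := by
  have h := W.integrable_info
  rw [joint, integrable_finsetSum_measure] at h
  have h := (h x (Finset.mem_univ x))
  rw [integrable_smul_measure (by simp) (by simp), integrable_map_measure
    W.measurable_info.aestronglyMeasurable measurable_prodMk_left.aemeasurable] at h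
  exact h

lemma condEntropy_eq_sum : W.condEntropy = ∑ x : Bool, 2⁻¹ * ∫ y, W.info (x, y) ∂(W.law x) := by
  have h := W.integrable_info
  rw [joint, integrable_finsetSum_measure] at h
  rw [condEntropy, joint, integral_finsetSum_measure h]
  refine Finset.sum_congr rfl fun x _ => ?_
  rw [integral_smul_measure, integral_map measurable_prodMk_left.aemeasurable
    W.measurable_info.aestronglyMeasurable]
  simp

lemma integral_density_mul (x : Bool) (g : 𝒴 → ℝ) :
    ∫ y, (W.density x y : ℝ) * g y ∂W.base = ∫ y, g y ∂(W.law x) := by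
  rw [law, integral_withDensity_eq_integral_smul (W.measurable_density x)]
  rfl

/-- Mutual information is bounded, so that the supremum in the definition of capacity is not a junk
value. -/
lemma mutualInfo_le_two {t : Bool → ℝ} (ht : t ∈ stdSimplex ℝ Bool) : W.mutualInfo t ≤ 2 := by
  have key : ∀ x, t x * ∫ y, (W.density x y : ℝ) *
      Real.log ((W.density x y : ℝ) / ∑ u : Bool, t u * (W.density u y : ℝ)) ∂W.base ≤ 1 := by
    intro x
    rw [integral_density_mul]
    set g : 𝒴 → ℝ := fun y => Real.log ((W.density x y : ℝ) / ∑ u : Bool, t u * (W.density u y : ℝ))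
    rcases (ht.1 x).eq_or_lt with h0 | h0
    · rw [← h0]; simp
    have h1 : t x ≤ 1 := by
      rw [← ht.2]; exact Finset.single_le_sum (fun u _ => ht.1 u) (Finset.mem_univ x)
    have hb : ∀ y, g y ≤ -Real.log (t x) := by
      intro y
      have hlog : 0 ≤ -Real.log (t x) := neg_nonneg.2 (Real.log_nonpos h0.le h1)
      rcases (NNReal.coe_nonneg (W.density x y)).eq_or_lt with hd | hd
      · simp only [g, ← hd]; simpa using hlog
      · have hs : t x * (W.density x y : ℝ) ≤ ∑ u : Bool, t u * (W.density u y : ℝ) :=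
          Finset.single_le_sum (f := fun u => t u * (W.density u y : ℝ))
            (fun u _ => mul_nonneg (ht.1 u) (NNReal.coe_nonneg _)) (Finset.mem_univ x)
        have hs0 : 0 < t x * (W.density x y : ℝ) := mul_pos h0 hd
        rw [← Real.log_inv]
        refine Real.log_le_log (div_pos hd (hs0.trans_le hs)) ?_
        rw [div_le_iff₀ (hs0.trans_le hs)]
        calc (W.density x y : ℝ) = (t x)⁻¹ * (t x * (W.density x y : ℝ)) := by field_simp
          _ ≤ _ := by gcongr
    have hI : ∫ y, g y ∂(W.law x) ≤ -Real.log (t x) := by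
      by_cases hg : Integrable g (W.law x)
      · refine (integral_mono hg (integrable_const _) hb).trans_eq ?_
        simp
      · rw [integral_undef hg]; exact neg_nonneg.2 (Real.log_nonpos h0.le h1)
    have hl := Real.one_sub_inv_le_log_of_pos h0
    calc _ ≤ t x * ((t x)⁻¹ - 1) := mul_le_mul_of_nonneg_left (by linarith) h0.le
      _ = 1 - t x := by field_simp
      _ ≤ 1 := by linarith
  rw [mutualInfo, Fintype.sum_bool]
  linarith [key true, key false]

/-- The uniform input distribution shows that the capacity is at least `ln 2 - H(X|Y)`. -/
lemma log_two_sub_condEntropy_le_capacity : Real.log 2 - W.condEntropy ≤ W.capacity := by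
  have hmem : (fun _ : Bool => (2⁻¹ : ℝ)) ∈ stdSimplex ℝ Bool := by
    refine ⟨fun _ => by norm_num, ?_⟩
    rw [Fintype.sum_bool]; norm_num
  have hbdd : BddAbove (W.mutualInfo '' stdSimplex ℝ Bool) :=
    ⟨2, by rintro _ ⟨t, ht, rfl⟩; exact W.mutualInfo_le_two ht⟩
  refine le_trans (le_of_eq ?_) (le_csSup hbdd ⟨_, hmem, rfl⟩)
  have key : ∀ x, ∫ y, (W.density x y : ℝ) *
      Real.log ((W.density x y : ℝ) / ∑ u : Bool, 2⁻¹ * (W.density u y : ℝ)) ∂W.base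
      = Real.log 2 - ∫ y, W.info (x, y) ∂(W.law x) := by
    intro x
    rw [integral_density_mul]
    have e : (fun y => Real.log ((W.density x y : ℝ) / ∑ u : Bool, 2⁻¹ * (W.density u y : ℝ)))
        =ᵐ[W.law x] fun y => Real.log 2 - W.info (x, y) := by
      filter_upwards [W.ae_posterior_pos x] with y hy
      rw [info, sub_neg_eq_add, ← Real.log_mul two_ne_zero hy.ne', posterior, ← Finset.mul_sum]
      congr 1
      simp only [div_eq_mul_inv, mul_inv, inv_inv]
      ring
    rw [integral_congr_ae e, integral_sub (integrable_const _) (W.integrable_info_mk x)]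
    simp
  have e : W.mutualInfo (fun _ => 2⁻¹)
      = ∑ x : Bool, 2⁻¹ * (Real.log 2 - ∫ y, W.info (x, y) ∂(W.law x)) :=
    Finset.sum_congr rfl fun x _ => by rw [← key x]
  rw [e, condEntropy_eq_sum, Fintype.sum_bool, Fintype.sum_bool]
  ring

end BinaryChannel

/-! ### The converse for a given threshold -/

namespace BinaryChannel

variable {𝒴 : Type*} [MeasurableSpace 𝒴] (W : BinaryChannel 𝒴)

lemma infoSeq_eq_of_pos {n : ℕ} {x : Fin n → Bool} {y : Fin n → 𝒴}
    (h : ∀ i, 0 < W.posterior (x i) (y i)) :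
    W.infoSeq x y = 1 / (n : ℝ) * ∑ i, W.info (x i, y i) := by
  rw [infoSeq, posteriorSeq, Real.log_prod fun i _ => (h i).ne']
  simp [info, Finset.sum_neg_distrib]

lemma lt_infoSeq_iff_of_pos {n : ℕ} (hn : 0 < n) {x : Fin n → Bool} {y : Fin n → 𝒴}
    (h : ∀ i, 0 < W.posterior (x i) (y i)) (a : ℝ) :
    a < W.infoSeq x y ↔ n * a < ∑ i, W.info (x i, y i) := by
  have hn' : (0 : ℝ) < n := by exact_mod_cast hn
  rw [W.infoSeq_eq_of_pos h, one_div, inv_mul_eq_div, lt_div_iff₀ hn', mul_comm]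

lemma integral_infoLaw : ∫ s, s ∂W.infoLaw = W.condEntropy := by
  rw [infoLaw, integral_map W.measurable_info.aemeasurable (by fun_prop), condEntropy]

/-- The tail probability in terms of independent copies of the conditional information. -/
lemma tailProb_eq {n : ℕ} (hn : 0 < n) (δ : ℝ) :
    W.tailProb n δ = (Measure.pi fun _ : Fin n => W.infoLaw).real
      {s | n * (W.condEntropy + δ) < ∑ i, s i} := by
  have hm : Measurable fun (ω : Fin n → Bool × 𝒴) i => W.info (ω i) :=
    measurable_pi_lambda _ fun i => W.measurable_info.comp (measurable_pi_apply i)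
  rw [infoLaw, ← Measure.pi_map_pi (fun _ => W.measurable_info.aemeasurable),
    map_measureReal_apply hm (measurableSet_lt measurable_const (by fun_prop)), tailProb]
  refine measureReal_congr ?_
  have hae : ∀ᵐ ω ∂(Measure.pi fun _ : Fin n => W.joint),
      ∀ i, 0 < W.posterior (ω i).1 (ω i).2 := ae_all_iff.2 fun i =>
    (Measure.quasiMeasurePreserving_eval (fun _ : Fin n => W.joint) i).ae W.ae_joint_posterior_pos
  filter_upwards [hae] with ω hω
  exact propext (W.lt_infoSeq_iff_of_pos hn hω _)

lemma measurable_posteriorSeq {n : ℕ} (x : Fin n → Bool) : Measurable (W.posteriorSeq x) :=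
  Finset.measurable_fun_prod _ fun i _ => (W.measurable_posterior (x i)).comp (measurable_pi_apply i)

lemma measurableSet_outerMirror {n : ℕ} (x : Fin n → Bool) (δ : ℝ) :
    MeasurableSet (W.outerMirror x δ) :=
  (measurableSet_lt measurable_const (W.measurable_posteriorSeq x)).inter
    (measurableSet_lt measurable_const
      ((Real.measurable_log.comp (W.measurable_posteriorSeq x)).const_mul _))

instance isProbabilityMeasure_seqLaw {n : ℕ} (x : Fin n → Bool) :
    IsProbabilityMeasure (W.seqLaw x) :=
  inferInstanceAs (IsProbabilityMeasure (Measure.pi fun i => W.law (x i)))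

instance isProbabilityMeasure_outputSeqLaw (n : ℕ) : IsProbabilityMeasure (W.outputSeqLaw n) :=
  inferInstanceAs (IsProbabilityMeasure (Measure.pi fun _ : Fin n => W.outputLaw))

/-- For a symmetric channel every input sequence sees its outer mirror image with the same
probability. -/
lemma IsSymmetric.seqLaw_outerMirror {W : BinaryChannel 𝒴} (h : W.IsSymmetric) {n : ℕ} (hn : 0 < n)
    (x : Fin n → Bool) (δ : ℝ) : (W.seqLaw x).real (W.outerMirror x δ) = W.tailProb n δ := by
  have hm : Measurable fun (y : Fin n → 𝒴) i => W.info (x i, y i) :=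
    measurable_pi_lambda _ fun i => (W.measurable_info_mk (x i)).comp (measurable_pi_apply i)
  have hsig : ∀ i, SigmaFinite ((W.law (x i)).map fun y => W.info (x i, y)) := fun i => by
    rw [h.map_law_info]; infer_instance
  have e : (W.seqLaw x).map (fun y i => W.info (x i, y i)) = Measure.pi fun _ => W.infoLaw := by
    rw [seqLaw, Measure.pi_map_pi (fun i => (W.measurable_info_mk (x i)).aemeasurable)]
    simp_rw [h.map_law_info]
  rw [W.tailProb_eq hn, ← e,
    map_measureReal_apply hm (measurableSet_lt measurable_const (by fun_prop))]
  refine measureReal_congr ?_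
  have hae : ∀ᵐ y ∂(W.seqLaw x), ∀ i, 0 < W.posterior (x i) (y i) := ae_all_iff.2 fun i =>
    (Measure.quasiMeasurePreserving_eval (fun i => W.law (x i)) i).ae (W.ae_posterior_pos (x i))
  filter_upwards [hae] with y hy
  have hpos : 0 < W.posteriorSeq x y := Finset.prod_pos fun i _ => hy i
  exact propext ⟨fun hh => (W.lt_infoSeq_iff_of_pos hn hy _).1 hh.2,
    fun hh => ⟨hpos, (W.lt_infoSeq_iff_of_pos hn hy _).2 hh⟩⟩

/-- On the outer mirror image of `x` the law of the output given `x` is at most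
`exp (n (ln 2 - H(X|Y) - δ))` times the unconditional law of the output. -/
lemma seqLaw_le_of_subset_outerMirror {n : ℕ} (hn : 0 < n) {x : Fin n → Bool} {δ : ℝ}
    {A : Set (Fin n → 𝒴)} (hA : MeasurableSet A) (hsub : A ⊆ W.outerMirror x δ) :
    (W.seqLaw x).real A
      ≤ Real.exp (n * (Real.log 2 - W.condEntropy - δ)) * (W.outputSeqLaw n).real A := by
  have hn' : (0 : ℝ) < n := by exact_mod_cast hn
  have hp := W.measurable_posterior
  have hsig : ∀ i, SigmaFinite (W.outputLaw.withDensity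
      fun y => ENNReal.ofReal (2 * W.posterior (x i) y)) := fun i => by
    rw [← W.law_eq_withDensity]; infer_instance
  have e : W.seqLaw x = (W.outputSeqLaw n).withDensity
      fun y => ∏ i, ENNReal.ofReal (2 * W.posterior (x i) (y i)) := by
    rw [outputSeqLaw, ← pi_withDensity (fun _ : Fin n => W.outputLaw)
      (f := fun i y => ENNReal.ofReal (2 * W.posterior (x i) y)) (fun i => by fun_prop), seqLaw]
    simp_rw [← W.law_eq_withDensity]
  have hpt : ∀ y ∈ A, ∏ i, ENNReal.ofReal (2 * W.posterior (x i) (y i))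
      ≤ ENNReal.ofReal (Real.exp (n * (Real.log 2 - W.condEntropy - δ))) := by
    intro y hy
    obtain ⟨hpos, hlt⟩ := hsub hy
    rw [← ENNReal.ofReal_prod_of_nonneg fun i _ =>
      mul_nonneg zero_le_two (W.posterior_nonneg _ _)]
    refine ENNReal.ofReal_le_ofReal ?_
    rw [Finset.prod_mul_distrib, Finset.prod_const, Finset.card_univ, Fintype.card_fin]
    change 2 ^ n * W.posteriorSeq x y ≤ _
    rw [← Real.log_le_iff_le_exp (by positivity), Real.log_mul (by positivity) hpos.ne',
      Real.log_pow]
    rw [infoSeq, neg_mul, one_div, inv_mul_eq_div, lt_neg, div_lt_iff₀ hn'] at hlt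
    linarith
  have hle : W.seqLaw x A ≤ ENNReal.ofReal (Real.exp (n * (Real.log 2 - W.condEntropy - δ)))
      * W.outputSeqLaw n A := by
    rw [e, withDensity_apply _ hA]
    refine (setLIntegral_mono' hA hpt).trans_eq ?_
    rw [setLIntegral_const]
  have := ENNReal.toReal_mono (ENNReal.mul_ne_top ENNReal.ofReal_ne_top (measure_ne_top _ _)) hle
  rwa [ENNReal.toReal_mul, ENNReal.toReal_ofReal (Real.exp_pos _).le] at this

lemma betaTerm_pos (hσ : 0 < W.sigmaH 0) {n : ℕ} (hn : 0 < n) {ε : ℝ} (h0 : 0 < ε) (h1 : ε < 1) :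
    0 < W.betaTerm n ε := by
  have hn' : (0 : ℝ) < n := by exact_mod_cast hn
  have := Real.log_neg h0 h1
  unfold betaTerm
  have : 0 < -2 * Real.log ε / n := div_pos (by linarith) hn'
  positivity

/-- The converse: codewords see their outer mirror images with probability at least `(1 + β) ε`, so
the part within the decision region has probability at least `β ε`. These parts are disjoint
subsets of `B_{n,δ}`, on which the output law dominates. -/
theorem converse {W : BinaryChannel 𝒴} (hsymm : W.IsSymmetric) (hσ : 0 < W.sigmaH 0) {n : ℕ}
    (hn : 0 < n) {ε : ℝ} (h0 : 0 < ε) (h1 : ε < 1) (c : ChannelCode 𝒴 n) (hc : c.maxError W ≤ ε)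
    {δ : ℝ} (hδ : (1 + W.betaTerm n ε) * ε ≤ W.tailProb n δ) : c.rate ≤ W.converseBound n ε δ := by
  have hn' : (0 : ℝ) < n := by exact_mod_cast hn
  have hβ := W.betaTerm_pos hσ hn h0 h1
  set β := W.betaTerm n ε
  set T := Real.exp (n * (Real.log 2 - W.condEntropy - δ))
  set A : Fin c.size → Set (Fin n → 𝒴) := fun m => W.outerMirror (c.encode m) δ ∩ c.region m
  have hAm : ∀ m, MeasurableSet (A m) := fun m =>
    (W.measurableSet_outerMirror _ δ).inter (c.measurableSet_region m)
  have hA : ∀ m, β * ε ≤ T * (W.outputSeqLaw n).real (A m) := by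
    intro m
    refine le_trans ?_ (W.seqLaw_le_of_subset_outerMirror hn (hAm m) Set.inter_subset_left)
    have he : (W.seqLaw (c.encode m)).real (c.region m)ᶜ ≤ ε :=
      (le_ciSup (f := fun m => (W.seqLaw (c.encode m)).real (c.region m)ᶜ)
        (Set.finite_range _).bddAbove m).trans hc
    have ht := hsymm.seqLaw_outerMirror hn (c.encode m) δ
    have hsplit : (W.seqLaw (c.encode m)).real (W.outerMirror (c.encode m) δ)
        ≤ (W.seqLaw (c.encode m)).real (A m) + (W.seqLaw (c.encode m)).real (c.region m)ᶜ := by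
      refine (measureReal_mono fun y hy => ?_).trans (measureReal_union_le _ _)
      by_cases hr : y ∈ c.region m
      · exact Or.inl ⟨hy, hr⟩
      · exact Or.inr hr
    linarith
  have hsum : ∑ m, (W.outputSeqLaw n).real (A m) ≤ W.probOuterUnion n δ := by
    rw [← measureReal_iUnion_fintype (fun i j hij => ((c.disjoint_region hij).mono
      Set.inter_subset_right Set.inter_subset_right)) hAm]
    exact measureReal_mono (Set.iUnion_subset fun m y hy => Set.mem_iUnion.2 ⟨c.encode m, hy.1⟩)
  have hM : (0 : ℝ) < c.size := by exact_mod_cast c.size_pos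
  have hmain : c.size * (β * ε) ≤ T * W.probOuterUnion n δ := by
    calc (c.size : ℝ) * (β * ε) = ∑ _m : Fin c.size, β * ε := by simp
      _ ≤ ∑ m, T * (W.outputSeqLaw n).real (A m) := Finset.sum_le_sum fun m _ => hA m
      _ = T * ∑ m, (W.outputSeqLaw n).real (A m) := by rw [Finset.mul_sum]
      _ ≤ _ := mul_le_mul_of_nonneg_left hsum (Real.exp_pos _).le
  have hpos : 0 < T * W.probOuterUnion n δ := lt_of_lt_of_le (by positivity) hmain
  have hP : 0 < W.probOuterUnion n δ := pos_of_mul_pos_right hpos (Real.exp_pos _).le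
  have hlog := Real.log_le_log (by positivity) hmain
  rw [Real.log_mul hM.ne' (by positivity), Real.log_mul hβ.ne' h0.ne',
    Real.log_mul (Real.exp_pos _).ne' hP.ne', Real.log_exp] at hlog
  have hcap := W.log_two_sub_condEntropy_le_capacity
  rw [ChannelCode.rate, converseBound, div_le_iff₀ hn', sub_mul, div_mul_cancel₀ _ hn'.ne']
  nlinarith

end BinaryChannel

/-! ### Tilted conditional information and the explicit forms of the bound -/

/-- Tilting by a function of a random variable tilts the law of that random variable. -/
lemma map_tilted_comp {Ω : Type*} [MeasurableSpace Ω] (μ : Measure Ω) {X : Ω → ℝ} {f : ℝ → ℝ}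
    (hX : Measurable X) (hf : Measurable f) :
    (μ.tilted fun ω => f (X ω)).map X = (μ.map X).tilted f := by
  ext s hs
  rw [Measure.map_apply hX hs, tilted_apply' _ _ (hX hs), tilted_apply' _ _ hs,
    setLIntegral_map hs (by fun_prop) hX, integral_map hX.aemeasurable (by fun_prop)]

namespace BinaryChannel

variable {𝒴 : Type*} [MeasurableSpace 𝒴] (W : BinaryChannel 𝒴)

lemma map_info_tiltedJoint (l : ℝ) :
    (W.tiltedJoint l).map W.info = W.infoLaw.tilted fun s => l * s :=
  map_tilted_comp W.joint W.measurable_info (measurable_const_mul l)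

lemma tiltedJoint_zero : W.tiltedJoint 0 = W.joint := by simp [tiltedJoint]

lemma infoLaw_tilted_zero : (W.infoLaw.tilted fun s => 0 * s) = W.infoLaw := by simp

lemma variance_infoLaw_tilted (l : ℝ) :
    variance (fun s => s) (W.infoLaw.tilted fun s => l * s) = variance W.info (W.tiltedJoint l) := by
  rw [← map_info_tiltedJoint, variance_map (by fun_prop) W.measurable_info.aemeasurable]
  rfl

lemma integral_infoLaw_tilted (l : ℝ) :
    ∫ s, s ∂(W.infoLaw.tilted fun s => l * s) = W.condEntropy + W.deltaOf l := by
  rw [← map_info_tiltedJoint, integral_map W.measurable_info.aemeasurable (by fun_prop), deltaOf]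
  ring

lemma thirdAbsMoment_infoLaw_tilted (l : ℝ) :
    thirdAbsMoment (fun s => s) (W.infoLaw.tilted fun s => l * s) = W.momentH l := by
  rw [← map_info_tiltedJoint, thirdAbsMoment,
    integral_map W.measurable_info.aemeasurable (by fun_prop),
    integral_map W.measurable_info.aemeasurable (by fun_prop)]
  rfl

lemma cgf_infoLaw (l : ℝ) : cgf (fun s => s) W.infoLaw l = cgf W.info W.joint l := by
  rw [cgf, cgf, mgf, mgf, infoLaw, integral_map W.measurable_info.aemeasurable (by fun_prop)]

lemma integrable_exp_infoLaw {l : ℝ} (hl : l ∈ integrableExpSet W.info W.joint) :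
    Integrable (fun s => Real.exp (l * s)) W.infoLaw := by
  rw [infoLaw, integrable_map_measure (by fun_prop) W.measurable_info.aemeasurable]
  exact hl

lemma integrable_abs_pow_three_infoLaw_tilted {l : ℝ}
    (hl : l ∈ interior (integrableExpSet W.info W.joint)) :
    Integrable (fun s => |s| ^ 3) (W.infoLaw.tilted fun s => l * s) := by
  rw [← map_info_tiltedJoint, integrable_map_measure (by fun_prop) W.measurable_info.aemeasurable]
  exact (memLp_tilted_mul hl 3).integrable_norm_pow (p := 3) (by norm_num)

/-- A conditional information that is not deterministic is not deterministic after tilting. -/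
lemma sigmaH_pos (hσ : 0 < W.sigmaH 0) {l : ℝ}
    (hl : l ∈ interior (integrableExpSet W.info W.joint)) : 0 < W.sigmaH l := by
  have hint : Integrable (fun ω => Real.exp (l * W.info ω)) W.joint :=
    integrable_of_mem_integrableExpSet (interior_subset hl)
  have : IsProbabilityMeasure (W.tiltedJoint l) := isProbabilityMeasure_tilted hint
  have hL : MemLp W.info 2 (W.tiltedJoint l) := memLp_tilted_mul hl 2
  refine Real.sqrt_pos.2 ((variance_nonneg _ _).lt_of_ne' fun h0 => ?_)
  have he : evariance W.info (W.tiltedJoint l) = 0 := by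
    rw [← hL.ofReal_variance_eq, h0, ENNReal.ofReal_zero]
  rw [evariance_eq_zero_iff W.measurable_info.aemeasurable] at he
  have he' : W.info =ᵐ[W.joint] fun _ => ∫ ω, W.info ω ∂(W.tiltedJoint l) :=
    (absolutelyContinuous_tilted hint).ae_le he
  rw [sigmaH, tiltedJoint_zero, variance_congr he', variance_eq_integral aemeasurable_const] at hσ
  simp at hσ

/-- The supremum that defines the rate function at `δ(λ)` is bounded, and the term for `λ` is a
lower bound. -/
lemma le_rateFn_deltaOf {l : ℝ} (hl0 : 0 ≤ l)
    (hl : l ∈ interior (integrableExpSet W.info W.joint)) :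
    l * (W.condEntropy + W.deltaOf l) - cgf W.info W.joint l ≤ W.rateFn (W.deltaOf l) := by
  have hint : Integrable (fun ω => Real.exp (l * W.info ω)) W.joint :=
    integrable_of_mem_integrableExpSet (interior_subset hl)
  have hp : IsProbabilityMeasure (W.tiltedJoint l) := isProbabilityMeasure_tilted hint
  refine le_csSup ⟨l * (W.condEntropy + W.deltaOf l) - cgf W.info W.joint l, ?_⟩
    ⟨l, ⟨hl0, interior_subset hl⟩, rfl⟩
  rintro _ ⟨k, hk, rfl⟩
  -- Jensen's inequality for the tilted law is the tangent line inequality for the convex `cgf`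
  have hm : W.condEntropy + W.deltaOf l = ∫ ω, W.info ω ∂(W.tiltedJoint l) := by
    rw [deltaOf]; ring
  have hI : Integrable W.info (W.tiltedJoint l) :=
    memLp_one_iff_integrable.1 (memLp_tilted_mul hl 1)
  have hkint : Integrable (fun ω => Real.exp (k * W.info ω)) W.joint := hk.2
  have hexp : ∀ ω, Real.exp (l * W.info ω) * Real.exp ((k - l) * W.info ω)
      = Real.exp (k * W.info ω) := fun ω => by
    rw [← Real.exp_add]; ring_nf
  have hE : Integrable (fun ω => Real.exp ((k - l) * W.info ω)) (W.tiltedJoint l) := by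
    rw [tiltedJoint, integrable_tilted_iff]
    · simpa only [smul_eq_mul, hexp] using hkint
    · exact hint
  have hJ := convexOn_exp.map_integral_le Real.continuous_exp.continuousOn isClosed_univ
    (Eventually.of_forall fun _ => Set.mem_univ _) (hI.const_mul (k - l)) hE
  have hr : ∫ ω, Real.exp ((k - l) * W.info ω) ∂(W.tiltedJoint l)
      = mgf W.info W.joint k / mgf W.info W.joint l := by
    rw [tiltedJoint, integral_exp_tilted, mgf, mgf]
    congr 2
    ext ω
    rw [Pi.add_apply, Real.exp_add, hexp]
  have hJ' : Real.exp (∫ ω, (k - l) * W.info ω ∂(W.tiltedJoint l))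
      ≤ mgf W.info W.joint k / mgf W.info W.joint l := hJ.trans_eq hr
  have h1 := mgf_pos hkint
  have h2 := mgf_pos hint
  have h3 := Real.log_le_log (Real.exp_pos _) hJ'
  rw [Real.log_exp, integral_const_mul, Real.log_div h1.ne' h2.ne', ← hm] at h3
  simp only [cgf]
  linarith

/-- The lower exponential estimate of the tail probability at the threshold `δ(λ)`. -/
lemma xiLower_mul_exp_le_tailProb (hσ : 0 < W.sigmaH 0) {n : ℕ} (hn : 0 < n) {l : ℝ}
    (hl0 : 0 ≤ l) (hl : (l : EReal) < W.lambdaStar) (hΔ : 2 * W.berryEsseenTerm n l < 1 / 2) :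
    W.xiLower n l * Real.exp (-(n * W.rateFn (W.deltaOf l))) ≤ W.tailProb n (W.deltaOf l) := by
  have hi := W.mem_interior_integrableExpSet hl
  have h := exponential_tail_lower_bound W.infoLaw hl0
    (W.integrable_exp_infoLaw (interior_subset hi)) rfl
    (W.integrable_abs_pow_three_infoLaw_tilted hi) (σ := W.sigmaH l) (Δ := W.berryEsseenTerm n l)
    (by rw [variance_infoLaw_tilted, sigmaH]) (W.sigmaH_pos hσ hi) hn
    (by rw [thirdAbsMoment_infoLaw_tilted, berryEsseenTerm]) hΔ
  rw [integral_infoLaw_tilted, cgf_infoLaw, ← W.tailProb_eq hn] at h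
  refine le_trans ?_ h
  have hr := W.le_rateFn_deltaOf hl0 hi
  have hξ : 0 ≤ W.xiLower n l := by
    unfold xiLower
    exact mul_nonneg (Real.exp_pos _).le (gaussianQ_mem_Ioo _).1.le
  refine mul_le_mul_of_nonneg_left (Real.exp_le_exp.2 ?_) hξ
  have : (0 : ℝ) ≤ n := n.cast_nonneg
  nlinarith

lemma momentH_nonneg (l : ℝ) : 0 ≤ W.momentH l := integral_nonneg fun _ => by positivity

lemma normalArg_pos (hσ : 0 < W.sigmaH 0) {n : ℕ} {ε : ℝ} (h0 : 0 < ε) : 0 < W.normalArg n ε := by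
  have h1 := berryEsseenC_nonneg
  have h2 := W.momentH_nonneg 0
  unfold normalArg
  positivity

lemma betaTerm_eq {n : ℕ} (ε : ℝ) :
    W.betaTerm n ε = √(-2 * Real.log ε) / W.sigmaH 0 / √(n : ℝ) := by
  rw [betaTerm, Real.sqrt_div' _ n.cast_nonneg]
  field_simp

/-- The normal approximation threshold `δ = (σ_H / √n) Q⁻¹(a_n(ε))` satisfies the threshold condition:
the Berry-Esseen error is part of `a_n(ε)`. -/
lemma le_tailProb_of_normalArg (hσ : 0 < W.sigmaH 0) {n : ℕ} (hn : 0 < n) {ε : ℝ} (h0 : 0 < ε)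
    (h1 : W.normalArg n ε < 1) :
    (1 + W.betaTerm n ε) * ε
      ≤ W.tailProb n (W.sigmaH 0 / √(n : ℝ) * gaussianQInv (W.normalArg n ε)) := by
  have hn' : (0 : ℝ) < n := by exact_mod_cast hn
  have hsn : 0 < √(n : ℝ) := Real.sqrt_pos.2 hn'
  have hi := W.zero_mem_interior_integrableExpSet
  have hv := W.variance_infoLaw_tilted 0
  have h3 := W.integrable_abs_pow_three_infoLaw_tilted hi
  have hM := W.thirdAbsMoment_infoLaw_tilted 0
  rw [infoLaw_tilted_zero] at hv h3 hM
  have hvar : √(variance (fun s => s) W.infoLaw) = W.sigmaH 0 := by rw [hv, sigmaH]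
  have hvar0 : 0 < variance (fun s : ℝ => s) W.infoLaw := Real.sqrt_pos.1 (hvar ▸ hσ)
  have h := gaussianQ_sub_le_tail W.infoLaw h3 hvar0 hn (gaussianQInv (W.normalArg n ε))
  rw [hM, hvar, gaussianQ_gaussianQInv (W.normalArg_pos hσ h0) h1, integral_infoLaw] at h
  rw [W.tailProb_eq hn]
  have e : (n : ℝ) * (W.condEntropy + W.sigmaH 0 / √(n : ℝ) * gaussianQInv (W.normalArg n ε))
      = n * W.condEntropy + gaussianQInv (W.normalArg n ε) * (√(n : ℝ) * W.sigmaH 0) := by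
    have : (n : ℝ) = √(n : ℝ) ^ 2 := (Real.sq_sqrt hn'.le).symm
    rw [mul_add]
    congr 1
    nth_rewrite 1 [this]
    field_simp
  rw [e]
  refine le_trans (le_of_eq ?_) h
  rw [betaTerm_eq, normalArg]
  field_simp
  ring

lemma converseBound_le_normalBound {n : ℕ} {ε : ℝ} :
    W.converseBound n ε (W.sigmaH 0 / √(n : ℝ) * gaussianQInv (W.normalArg n ε))
      ≤ W.normalBound n ε := by
  rw [converseBound, normalBound]
  have h : Real.log (W.probOuterUnion n
      (W.sigmaH 0 / √(n : ℝ) * gaussianQInv (W.normalArg n ε))) ≤ 0 :=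
    Real.log_nonpos measureReal_nonneg measureReal_le_one
  have := div_nonpos_of_nonpos_of_nonneg h (Nat.cast_nonneg (α := ℝ) n)
  rw [sub_div]
  linarith

/-- The expansion of the normal approximation form: `Q⁻¹` is differentiable at `ε`, so replacing
`a_n(ε) = ε + O(1/√n)` by `ε` changes the term `(σ_H / √n) Q⁻¹` by `O(1/n)`. -/
lemma normalBound_sub_isBigO (hσ : 0 < W.sigmaH 0) {ε : ℝ} (h0 : 0 < ε) (h1 : ε < 1) :
    (fun n : ℕ => W.normalBound n ε -
        (W.capacity - W.sigmaH 0 / √(n : ℝ) * gaussianQInv ε + Real.log n / (2 * n)))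
      =O[atTop] fun n : ℕ => 1 / (n : ℝ) := by
  set K := √(-2 * Real.log ε) / W.sigmaH 0 * ε + berryEsseenC * W.momentH 0 / W.sigmaH 0 ^ 3
  set b := √(-2 * Real.log ε) / W.sigmaH 0 with hb
  have hb0 : 0 < b := div_pos (Real.sqrt_pos.2 (by linarith [Real.log_neg h0 h1])) hσ
  have harg : ∀ n : ℕ, W.normalArg n ε = ε + 1 / √(n : ℝ) * K := fun n => rfl
  have hsqrt : Tendsto (fun n : ℕ => 1 / √(n : ℝ)) atTop (nhds 0) := by
    simp only [one_div]
    exact tendsto_inv_atTop_zero.comp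
      (Real.tendsto_sqrt_atTop.comp tendsto_natCast_atTop_atTop)
  have hlim : Tendsto (fun n : ℕ => ε + 1 / √(n : ℝ) * K) atTop (nhds ε) := by
    simpa using (hsqrt.mul_const K).const_add ε
  have hQ : (fun n : ℕ => gaussianQInv (ε + 1 / √(n : ℝ) * K) - gaussianQInv ε)
      =O[atTop] fun n : ℕ => 1 / √(n : ℝ) := by
    refine ((hasDerivAt_gaussianQInv h0 h1).isBigO_sub.comp_tendsto hlim).trans ?_
    refine (Asymptotics.isBigO_const_mul_self K (fun n : ℕ => 1 / √(n : ℝ)) atTop).congr_left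
      fun n => ?_
    simp [mul_comm]
  have hS : (fun n : ℕ => W.sigmaH 0 / √(n : ℝ)
        * (gaussianQInv (ε + 1 / √(n : ℝ) * K) - gaussianQInv ε))
      =O[atTop] fun n : ℕ => 1 / (n : ℝ) := by
    have hc : (fun n : ℕ => W.sigmaH 0 / √(n : ℝ)) =O[atTop] fun n : ℕ => 1 / √(n : ℝ) :=
      (Asymptotics.isBigO_const_mul_self (W.sigmaH 0) (fun n : ℕ => 1 / √(n : ℝ)) atTop).congr_left
        fun n => by ring
    refine (hc.mul hQ).congr_right fun n => ?_
    rw [← mul_div_mul_comm, one_mul, Real.mul_self_sqrt n.cast_nonneg]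
  have hL : (fun n : ℕ => -(Real.log ε + Real.log b) * (1 / (n : ℝ)))
      =O[atTop] fun n : ℕ => 1 / (n : ℝ) := Asymptotics.isBigO_const_mul_self _ _ _
  refine (hL.sub hS).congr' ?_ EventuallyEq.rfl
  filter_upwards [eventually_gt_atTop 0] with n hn
  have hn' : (0 : ℝ) < n := by exact_mod_cast hn
  have hsn : 0 < √(n : ℝ) := Real.sqrt_pos.2 hn'
  rw [normalBound, harg, betaTerm_eq, Real.log_div hb0.ne' hsn.ne', Real.log_sqrt hn'.le]
  field_simp
  ring

end BinaryChannel

theorem corollary1 {𝒴 : Type*} [MeasurableSpace 𝒴] (W : BinaryChannel 𝒴)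
    (hsymm : W.IsSymmetric) (hσ : 0 < W.sigmaH 0) :
    -- every block length, every code with maximum error probability at most `ε`
    (∀ (n : ℕ) (ε : ℝ) (c : ChannelCode 𝒴 n), 0 < n → 0 < ε → ε < 1 → c.maxError W ≤ ε →
      -- `δ` as in the threshold condition
      (∀ δ : ℝ, (1 + W.betaTerm n ε) * ε ≤ W.tailProb n δ → c.rate ≤ W.converseBound n ε δ) ∧
      -- the case where `δ = δ(λ)` solves the equation with the lower exponential estimate
      (∀ l : ℝ, 0 ≤ l → (l : EReal) < W.lambdaStar → 2 * W.berryEsseenTerm n l < 1 / 2 →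
        (1 + W.betaTerm n ε) * ε
            = W.xiLower n l * Real.exp (-(n * W.rateFn (W.deltaOf l))) →
        c.rate ≤ W.converseBound n ε (W.deltaOf l)) ∧
      -- the bound in normal approximation form
      (W.normalArg n ε < 1 → c.rate ≤ W.normalBound n ε)) ∧
    -- the expansion of the latter bound for constant `ε`
    (∀ ε : ℝ, 0 < ε → ε < 1 →
      (fun n : ℕ => W.normalBound n ε -
          (W.capacity - W.sigmaH 0 / √(n : ℝ) * gaussianQInv ε + Real.log n / (2 * n)))
        =O[atTop] fun n : ℕ => 1 / (n : ℝ)) := by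
  refine ⟨fun n ε c hn h0 h1 hc => ?_, fun ε h0 h1 => W.normalBound_sub_isBigO hσ h0 h1⟩
  have hconv : ∀ δ : ℝ, (1 + W.betaTerm n ε) * ε ≤ W.tailProb n δ →
      c.rate ≤ W.converseBound n ε δ := fun δ hδ =>
    BinaryChannel.converse hsymm hσ hn h0 h1 c hc hδ
  refine ⟨hconv, fun l hl0 hl hΔ heq => hconv _ ?_, fun ha => ?_⟩
  · exact heq.trans_le (W.xiLower_mul_exp_le_tailProb hσ hn hl0 hl hΔ)
  · exact (hconv _ (W.le_tailProb_of_normalArg hσ hn h0 ha)).trans W.converseBound_le_normalBound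

end
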